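/- **Theorem (Itô formula, inhomogeneous).** Let $2\le p<3$, $T>0$, $\Delta=\{0\le s\le t\le T\}$. A $p$-rough path in a Euclidean space $V$ is a continuous map $X=(1,X^1,X^2):\Delta\to\mathbb R\oplus V\oplus V^{\otimes2}$ satisfying Chen's identity $X_{s,t}=X_{s,u}\otimes X_{u,t}$ and $\sup_D\sum_l|X^i_{t_{l-1},t_l}|^{p/i}<\infty$ for $i=1,2$ (supremum over finite partitions $D$ of $[0,T]$); write $X_t:=X^1_{0,t}$. It is geometric if it is a limit, in the $p$-variation distance $\sum_{i=1,2}\bigl(\sup_D\sum_l|X^i_{t_{l-1},t_l}-Y^i_{t_{l-1},t_l}|^{p/i}\bigr)^{i/p}$, of canonical lifts $(1,\,x_t-x_s,\,\int_s^t(x_u-x_s)\otimes dx_u)$ of continuous paths $x$ of bounded variation. For a rough path $X$ in $V$ and $f:V\to L(V,W)$, the rough integral $\int f(X)\,dX$ is the $p$-rough path $Y$ in $W$ such that, for some control $\omega$ (a non-negative, continuous, super-additive function on $\Delta$ vanishing on the diagonal) and some $\theta>1$, for all $(s,t)\in\Delta$, $$|Y^1_{s,t}-f(X_s)X^1_{s,t}-Df(X_s)X^2_{s,t}|\le\omega(s,t)^\theta,\qquad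 |Y^2_{s,t}-(f(X_s)\otimes f(X_s))X^2_{s,t}|\le\omega(s,t)^\theta;$$ its levels are written $\int_s^t f(X)\,dX^1:=Y^1_{s,t}$ and $\int_s^t f(X)\,dX^2:=Y^2_{s,t}$. Let $X$ be a geometric $p$-rough path in $\mathbb R^d$, and let $\varphi:[0,T]\to\mathbb R^d\otimes\mathbb R^d$ be continuous with finite $q$-variation for some $0<q\le p/2$. Put $X(\varphi)_{s,t}=(1,\,X^1_{s,t},\,X^2_{s,t}-(\varphi_t-\varphi_s))$. The space-time rough path $\widetilde X=(X,t)$ in $\mathbb R^{d+1}=\mathbb R^d\oplus\mathbb R$ is given by $$\widetilde X^1_{s,t}=(X^1_{s,t},\,t-s),\qquad \widetilde X^2_{s,t}=\Bigl(X^2_{s,t},\ \int_s^tX^1_{s,u}\,du,\ \int_s^t(u-s)\,dX_u,\ \tfrac12(t-s)^2\Bigr)$$ with Young cross integrals, and $\widetilde X(\varphi)$ is given by the same formula with $X^2_{s,t}$ replaced by $X^2_{s,t}-(\varphi_t-\varphi_s)$. Let $W$ be a finite-dimensional Euclidean space (for example $\mathbb R^e$), and let $F:\mathbb R^{d+1}\to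 W$ be $\mathrm{Lip}(\gamma)$ for some $\gamma>p$: if $k$ is the integer with $k<\gamma\le k+1$, then $F$ is $C^k$ with bounded derivatives of orders $0,\dots,k$, and $D^kF$ is $(\gamma-k)$-Hölder. Then $\widetilde X$ and $\widetilde X(\varphi)$ are well-defined $p$-rough paths, the rough integrals $F_{\mathfrak R}((X,t)):=\int DF(\widetilde X)\,d\widetilde X$ and $\int DF(\widetilde X(\varphi))\,d\widetilde X(\varphi)$ exist, and for all $0\le s\le t\le T$: (i) $\displaystyle F(X_t,t)-F(X_s,s)=\int_s^tDF(\widetilde X)\,d\widetilde X^1$; (ii) $\displaystyle F(X_t,t)-F(X_s,s)=\int_s^tDF(\widetilde X(\varphi))\,d\widetilde X(\varphi)^1+\int_s^tD_x^2F(X_u,u)\,d\varphi_u$; (iii) $$\begin{aligned}F_{\mathfrak R}((X,t))^2_{s,t}={}&\int_s^tDF(\widetilde X(\varphi))\,d\widetilde X(\varphi)^2+\int_s^tD_xF(X_u,u)\otimes D_xF(X_u,u)\,d\varphi_u\\&+\int_s^t\Bigl(\int_s^uD_x^2F(X_r,r)\,d\varphi_r\Bigr)\otimes dF(X_u,u)\\&+\int_s^t\bigl(F(X_u,u)-F(X_s,s)\bigr)\otimes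 D_x^2F(X_u,u)\,d\varphi_u\\&-\int_s^t\Bigl(\int_s^uD_x^2F(X_r,r)\,d\varphi_r\Bigr)\otimes D_x^2F(X_u,u)\,d\varphi_u.\end{aligned}$$ The integrals against $d\varphi_u$, $d\varphi_r$ and $dF(X_u,u)$ are Young integrals: the continuous integrand and integrator have finite $a$- and $b$-variation for some $a,b\ge1$ with $1/a+1/b>1$, and the integral is the limit of the Riemann–Stieltjes sums as the mesh tends to $0$. -/

import Mathlib

open scoped TensorProduct ENNReal

noncomputable section

namespace RoughIto

/-! ### Partitions, `r`-variation, controls -/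

/-- A finite partition `a = pt 0 < pt 1 < ⋯ < pt n = b` of the interval `[a, b]`. -/
structure IntervalPartition (a b : ℝ) where
  n : ℕ
  pt : ℕ → ℝ
  first : pt 0 = a
  last : pt n = b
  lt : ∀ i < n, pt i < pt (i + 1)

/-- The `r`-variation functional `sup_D ∑ ‖Z (t_{l-1}, t_l)‖ ^ r` over all finite partitions `D`
of `[a, b]`, for a two-parameter function `Z`. -/
def pVar {E : Type*} [NormedAddCommGroup E] (r a b : ℝ) (Z : ℝ → ℝ → E) : ℝ≥0∞ :=
  ⨆ D : IntervalPartition a b, ∑ i ∈ Finset.range D.n, ‖Z (D.pt i) (D.pt (i + 1))‖ₑ ^ r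

/-- `Z` has finite `r`-variation on `[a, b]`. -/
def HasFinitePVar {E : Type*} [NormedAddCommGroup E] (r a b : ℝ) (Z : ℝ → ℝ → E) : Prop :=
  pVar r a b Z < ∞

/-- The increments `g_{s,t} = g_t - g_s` of a path. -/
def incr {E : Type*} [NormedAddCommGroup E] (g : ℝ → E) (s t : ℝ) : E := g t - g s

/-- The closed simplex `{(s, t) : 0 ≤ s ≤ t ≤ T}`. -/
def simplex (T : ℝ) : Set (ℝ × ℝ) := {z | 0 ≤ z.1 ∧ z.1 ≤ z.2 ∧ z.2 ≤ T}

/-- A control on the simplex: a non-negative, continuous, super-additive function that vanishes on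
the diagonal. -/
structure IsControl (T : ℝ) (ω : ℝ → ℝ → ℝ) : Prop where
  nonneg : ∀ s t, 0 ≤ s → s ≤ t → t ≤ T → 0 ≤ ω s t
  continuousOn : ContinuousOn (fun z : ℝ × ℝ => ω z.1 z.2) (simplex T)
  superadd : ∀ s u t, 0 ≤ s → s ≤ u → u ≤ t → t ≤ T → ω s u + ω u t ≤ ω s t
  diag : ∀ t, 0 ≤ t → t ≤ T → ω t t = 0

/-! ### Young integrals -/

/-- `I` is the limit, as the mesh of the partition `D` of `[s, t]` tends to `0`, of the
Riemann–Stieltjes sums `∑ f (ξ_l) (g (t_l) - g (t_{l-1}))`, with arbitrary tags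
`ξ_l ∈ [t_{l-1}, t_l]`. The integrand is operator-valued, so that products such as `⊗` are
covered. -/
def IsRSLimit {G C : Type*} [NormedAddCommGroup G] [NormedSpace ℝ G]
    [NormedAddCommGroup C] [NormedSpace ℝ C]
    (f : ℝ → G →L[ℝ] C) (g : ℝ → G) (s t : ℝ) (I : C) : Prop :=
  ∀ ε > 0, ∃ δ > 0, ∀ (D : IntervalPartition s t) (ξ : ℕ → ℝ),
    (∀ i < D.n, D.pt (i + 1) - D.pt i < δ) →
    (∀ i < D.n, D.pt i ≤ ξ i ∧ ξ i ≤ D.pt (i + 1)) →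
    ‖(∑ i ∈ Finset.range D.n, f (ξ i) (g (D.pt (i + 1)) - g (D.pt i))) - I‖ < ε

/-- `I` is the Young integral `∫_s^t f dg`: the integrand and the integrator are continuous and
have finite `r`- and `q`-variation on `[s, t]` for some exponents `r, q ≥ 1` with
`1/r + 1/q > 1`, and `I` is the limit of the Riemann–Stieltjes sums. -/
structure HasYoungIntegral {G C : Type*} [NormedAddCommGroup G] [NormedSpace ℝ G]
    [NormedAddCommGroup C] [NormedSpace ℝ C]
    (f : ℝ → G →L[ℝ] C) (g : ℝ → G) (s t : ℝ) (I : C) : Prop where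
  continuousOn_left : ContinuousOn f (Set.Icc s t)
  continuousOn_right : ContinuousOn g (Set.Icc s t)
  variation : ∃ r q : ℝ, 1 ≤ r ∧ 1 ≤ q ∧ 1 < 1 / r + 1 / q ∧
    HasFinitePVar r s t (incr f) ∧ HasFinitePVar q s t (incr g)
  limit : IsRSLimit f g s t I

/-- `∫_s^t f dg` exists as a Young integral. -/
def YoungIntegrable {G C : Type*} [NormedAddCommGroup G] [NormedSpace ℝ G]
    [NormedAddCommGroup C] [NormedSpace ℝ C]
    (f : ℝ → G →L[ℝ] C) (g : ℝ → G) (s t : ℝ) : Prop :=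
  ∃ I : C, HasYoungIntegral f g s t I

open Classical in
/-- The value of the Young integral `∫_s^t f dg` (with value `0` if it does not exist). -/
def youngIntegral {G C : Type*} [NormedAddCommGroup G] [NormedSpace ℝ G]
    [NormedAddCommGroup C] [NormedSpace ℝ C]
    (f : ℝ → G →L[ℝ] C) (g : ℝ → G) (s t : ℝ) : C :=
  if h : YoungIntegrable f g s t then h.choose else 0

/-! ### Tensor operations -/

/-- The operator `w ↦ v ⊗ w`. -/
def tmulL {V W : Type*} [NormedAddCommGroup V] [InnerProductSpace ℝ V] [FiniteDimensional ℝ V]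
    [NormedAddCommGroup W] [InnerProductSpace ℝ W] [FiniteDimensional ℝ W]
    (v : V) : W →L[ℝ] V ⊗[ℝ] W :=
  LinearMap.toContinuousLinearMap (TensorProduct.mk ℝ V W v)

/-- The linear map on `V ⊗ V` induced by a bilinear map on `V`: `v ⊗ w ↦ B v w`. -/
def contract {V W : Type*} [NormedAddCommGroup V] [InnerProductSpace ℝ V] [FiniteDimensional ℝ V]
    [NormedAddCommGroup W] [InnerProductSpace ℝ W]
    (B : V →L[ℝ] V →L[ℝ] W) : V ⊗[ℝ] V →L[ℝ] W :=
  LinearMap.toContinuousLinearMap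
    (TensorProduct.lift ((ContinuousLinearMap.coeLM ℝ).comp B.toLinearMap))

@[simp] theorem tmulL_apply {V W : Type*} [NormedAddCommGroup V] [InnerProductSpace ℝ V]
    [FiniteDimensional ℝ V] [NormedAddCommGroup W] [InnerProductSpace ℝ W] [FiniteDimensional ℝ W]
    (v : V) (w : W) : tmulL v w = v ⊗ₜ[ℝ] w := rfl

@[simp] theorem contract_tmul {V W : Type*} [NormedAddCommGroup V] [InnerProductSpace ℝ V]
    [FiniteDimensional ℝ V] [NormedAddCommGroup W] [InnerProductSpace ℝ W]
    (B : V →L[ℝ] V →L[ℝ] W) (v w : V) : contract B (v ⊗ₜ[ℝ] w) = B v w := rfl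

/-! ### Rough paths of roughness `2 ≤ p < 3` -/

/-- A function `(s, t) ↦ (1, X¹_{s,t}, X²_{s,t})` into the truncated tensor algebra
`T⁽²⁾(V) = ℝ ⊕ V ⊕ V ⊗ V`; only its values on the simplex `0 ≤ s ≤ t ≤ T` matter. -/
structure TwoLevel (V : Type*) [NormedAddCommGroup V] [InnerProductSpace ℝ V] where
  lvl1 : ℝ → ℝ → V
  lvl2 : ℝ → ℝ → V ⊗[ℝ] V

/-- The path `X_t := X¹_{0,t}`. -/
def TwoLevel.path {V : Type*} [NormedAddCommGroup V] [InnerProductSpace ℝ V]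
    (X : TwoLevel V) (t : ℝ) : V := X.lvl1 0 t

/-- `X` is a `p`-rough path on `[0, T]` (for `2 ≤ p < 3`): it is continuous, satisfies Chen's
identity `X_{s,t} = X_{s,u} ⊗ X_{u,t}`, and has finite `p`-variation. -/
structure IsRoughPath {V : Type*} [NormedAddCommGroup V] [InnerProductSpace ℝ V]
    (p T : ℝ) (X : TwoLevel V) : Prop where
  continuousOn_lvl1 : ContinuousOn (fun z : ℝ × ℝ => X.lvl1 z.1 z.2) (simplex T)
  continuousOn_lvl2 : ContinuousOn (fun z : ℝ × ℝ => X.lvl2 z.1 z.2) (simplex T)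
  chen_lvl1 : ∀ s u t, 0 ≤ s → s ≤ u → u ≤ t → t ≤ T → X.lvl1 s t = X.lvl1 s u + X.lvl1 u t
  chen_lvl2 : ∀ s u t, 0 ≤ s → s ≤ u → u ≤ t → t ≤ T →
    X.lvl2 s t = X.lvl2 s u + X.lvl1 s u ⊗ₜ[ℝ] X.lvl1 u t + X.lvl2 u t
  finite_lvl1 : HasFinitePVar p 0 T X.lvl1
  finite_lvl2 : HasFinitePVar (p / 2) 0 T X.lvl2

/-- The `p`-variation distance `d_p`. -/
def pVarDist {V : Type*} [NormedAddCommGroup V] [InnerProductSpace ℝ V]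
    (p T : ℝ) (X Y : TwoLevel V) : ℝ≥0∞ :=
  pVar p 0 T (fun s t => X.lvl1 s t - Y.lvl1 s t) ^ (1 / p) +
    pVar (p / 2) 0 T (fun s t => X.lvl2 s t - Y.lvl2 s t) ^ (2 / p)

/-- `L` is the canonical lift on `[0, T]` of a continuous path `x` of bounded variation: its
second level is the iterated integral `∫_s^t (x_u - x_s) ⊗ dx_u`. -/
structure IsCanonicalLift {V : Type*} [NormedAddCommGroup V] [InnerProductSpace ℝ V]
    [FiniteDimensional ℝ V] (T : ℝ) (x : ℝ → V) (L : TwoLevel V) : Prop where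
  continuousOn : ContinuousOn x (Set.Icc 0 T)
  boundedVariation : BoundedVariationOn x (Set.Icc 0 T)
  lvl1_eq : ∀ s t, 0 ≤ s → s ≤ t → t ≤ T → L.lvl1 s t = x t - x s
  lvl2_eq : ∀ s t, 0 ≤ s → s ≤ t → t ≤ T →
    HasYoungIntegral (fun u => tmulL (x u - x s)) x s t (L.lvl2 s t)

/-- `X` is a geometric `p`-rough path: a rough path that is the limit, in the distance `d_p`, of
canonical lifts of continuous paths of bounded variation. -/
def IsGeometricRoughPath {V : Type*} [NormedAddCommGroup V] [InnerProductSpace ℝ V]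
    [FiniteDimensional ℝ V] (p T : ℝ) (X : TwoLevel V) : Prop :=
  IsRoughPath p T X ∧ ∃ (x : ℕ → ℝ → V) (L : ℕ → TwoLevel V),
    (∀ n, IsCanonicalLift T (x n) (L n)) ∧
    Filter.Tendsto (fun n => pVarDist p T (L n) X) Filter.atTop (nhds 0)

/-- The perturbation `X(φ)_{s,t} = (1, X¹_{s,t}, X²_{s,t} - (φ_t - φ_s))`. -/
def perturb {V : Type*} [NormedAddCommGroup V] [InnerProductSpace ℝ V]
    (X : TwoLevel V) (φ : ℝ → V ⊗[ℝ] V) : TwoLevel V where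
  lvl1 := X.lvl1
  lvl2 := fun s t => X.lvl2 s t - (φ t - φ s)

/-! ### Rough integrals of one-forms -/

/-- The almost rough path `Ŷ¹_{s,t} = f(X_s) X¹_{s,t} + Df(X_s) X²_{s,t}`,
`Ŷ²_{s,t} = (f(X_s) ⊗ f(X_s)) X²_{s,t}` of a one-form `f : V → L(V, W)`. -/
def almostIntegral {V W : Type*} [NormedAddCommGroup V] [InnerProductSpace ℝ V]
    [FiniteDimensional ℝ V] [NormedAddCommGroup W] [InnerProductSpace ℝ W]
    (f : V → V →L[ℝ] W) (X : TwoLevel V) : TwoLevel W where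
  lvl1 := fun s t => f (X.path s) (X.lvl1 s t) + contract (fderiv ℝ f (X.path s)) (X.lvl2 s t)
  lvl2 := fun s t => TensorProduct.mapL (f (X.path s)) (f (X.path s)) (X.lvl2 s t)

/-- `Y = ∫ f(X) dX`: `Y` is the rough path associated with the almost rough path `Ŷ`, that is,
`Y` is a `p`-rough path with `|Yⁱ_{s,t} - Ŷⁱ_{s,t}| ≤ ω(s,t)^θ`, `i = 1, 2`, for some control `ω`
and some `θ > 1`. -/
def IsRoughIntegral {V W : Type*} [NormedAddCommGroup V] [InnerProductSpace ℝ V]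
    [FiniteDimensional ℝ V] [NormedAddCommGroup W] [InnerProductSpace ℝ W]
    (p T : ℝ) (f : V → V →L[ℝ] W) (X : TwoLevel V) (Y : TwoLevel W) : Prop :=
  IsRoughPath p T Y ∧ ∃ (ω : ℝ → ℝ → ℝ) (θ : ℝ), IsControl T ω ∧ 1 < θ ∧
    ∀ s t, 0 ≤ s → s ≤ t → t ≤ T →
      ‖Y.lvl1 s t - (almostIntegral f X).lvl1 s t‖ ≤ ω s t ^ θ ∧
      ‖Y.lvl2 s t - (almostIntegral f X).lvl2 s t‖ ≤ ω s t ^ θ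

/-! ### Lipschitz functions in the sense of Stein -/

/-- `F` is `Lip(γ)`, `γ > 0`: with `k < γ ≤ k + 1`, `F` is `k` times continuously differentiable,
its derivatives of order `0, …, k` are bounded and the `k`-th one is `(γ - k)`-Hölder. -/
def IsLip {V W : Type*} [NormedAddCommGroup V] [NormedSpace ℝ V]
    [NormedAddCommGroup W] [NormedSpace ℝ W] (γ : ℝ) (F : V → W) : Prop :=
  ∃ (k : ℕ) (M : ℝ), (k : ℝ) < γ ∧ γ ≤ k + 1 ∧ ContDiff ℝ k F ∧
    (∀ j ≤ k, ∀ x, ‖iteratedFDeriv ℝ j F x‖ ≤ M) ∧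
    ∀ x y, ‖iteratedFDeriv ℝ k F x - iteratedFDeriv ℝ k F y‖ ≤ M * ‖x - y‖ ^ (γ - k)

/-! ### Space-time rough paths -/

/-- The Euclidean space `V ⊕ ℝ` of pairs `(x, t)`. -/
abbrev SpaceTime (V : Type*) := WithLp 2 (V × ℝ)

/-- The point `(x, t)`. -/
def pt {V : Type*} (x : V) (t : ℝ) : SpaceTime V := WithLp.toLp 2 (x, t)

/-- The embedding `x ↦ (x, 0)` of space into space-time. -/
def inSpace (V : Type*) [NormedAddCommGroup V] [InnerProductSpace ℝ V] : V →L[ℝ] SpaceTime V :=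
  ((WithLp.prodContinuousLinearEquiv 2 ℝ V ℝ).symm : V × ℝ →L[ℝ] SpaceTime V).comp
    (ContinuousLinearMap.inl ℝ V ℝ)

/-- The unit vector `(0, 1)` in the time direction. -/
def timeVec (V : Type*) [NormedAddCommGroup V] : SpaceTime V := pt 0 1

@[simp] theorem inSpace_apply {V : Type*} [NormedAddCommGroup V] [InnerProductSpace ℝ V] (x : V) :
    inSpace V x = pt x 0 := rfl

/-- The integrand `u ↦ (r ↦ r • X¹_{s,u})` of the cross integral `∫_s^t X¹_{s,u} du`. -/
def crossLeft {V : Type*} [NormedAddCommGroup V] [InnerProductSpace ℝ V]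
    (X : TwoLevel V) (s : ℝ) : ℝ → ℝ →L[ℝ] V :=
  fun u => ContinuousLinearMap.toSpanSingleton ℝ (X.lvl1 s u)

/-- The integrand `u ↦ (u - s) • id` of the cross integral `∫_s^t (u - s) dX_u`. -/
def crossRight (V : Type*) [NormedAddCommGroup V] [InnerProductSpace ℝ V]
    (s : ℝ) : ℝ → V →L[ℝ] V :=
  fun u => (u - s) • ContinuousLinearMap.id ℝ V

/-- The space-time path `X̃ = (X, t)`, with `X̃¹_{s,t} = (X¹_{s,t}, t - s)` and second level
`(X²_{s,t}, ∫_s^t X¹_{s,u} du, ∫_s^t (u - s) dX_u, (t - s)²/2)`, the four components belonging to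
`V ⊗ V`, `V ⊗ ℝ`, `ℝ ⊗ V` and `ℝ ⊗ ℝ`. -/
def spaceTime {V : Type*} [NormedAddCommGroup V] [InnerProductSpace ℝ V]
    (X : TwoLevel V) : TwoLevel (SpaceTime V) where
  lvl1 := fun s t => pt (X.lvl1 s t) (t - s)
  lvl2 := fun s t =>
    TensorProduct.mapL (inSpace V) (inSpace V) (X.lvl2 s t)
      + inSpace V (youngIntegral (crossLeft X s) (fun u => u) s t) ⊗ₜ[ℝ] timeVec V
      + timeVec V ⊗ₜ[ℝ] inSpace V (youngIntegral (crossRight V s) X.path s t)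
      + ((t - s) ^ 2 / 2) • (timeVec V ⊗ₜ[ℝ] timeVec V)

/-! ### Partial derivatives in the space variable -/

/-- `D_x F(x, t)`. -/
def Dx {V W : Type*} [NormedAddCommGroup V] [InnerProductSpace ℝ V]
    [NormedAddCommGroup W] [InnerProductSpace ℝ W]
    (F : SpaceTime V → W) (x : V) (t : ℝ) : V →L[ℝ] W :=
  fderiv ℝ (fun y => F (pt y t)) x

/-- `D_x² F(x, t)`, as a linear map on `V ⊗ V`. -/
def Dxx {V W : Type*} [NormedAddCommGroup V] [InnerProductSpace ℝ V] [FiniteDimensional ℝ V]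
    [NormedAddCommGroup W] [InnerProductSpace ℝ W]
    (F : SpaceTime V → W) (x : V) (t : ℝ) : V ⊗[ℝ] V →L[ℝ] W :=
  contract (fderiv ℝ (fun y => Dx F y t) x)

end RoughIto

end

open RoughIto

/-!
Every regularity assumption is expressed through one *clock*: a continuous monotone function `H` on
`[0, T]` such that `X¹ = O((H t - H s) ^ (1 / p))`, `X² = O((H t - H s) ^ (2 / p))`,
`φ t - φ s = O((H t - H s) ^ (2 / p))` and `t - s = O(H t - H s)`. The variation of a continuous
two-parameter function over `[0, t]` is continuous in `t` (`isClock_of_split`, `exists_clock`), and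
such variations, added up, give `H`. The calculus of orders `BigO` replaces all estimates with
controls; an additive function of order `> 1` vanishes (`eq_zero_of_additive`), which gives the
uniqueness of rough integrals (`IsRoughIntegral.unique`).

All integrals come from the sewing lemma (`exists_sewing`): a function that is additive up to order
`θ > 1` is the increment of a path up to the same order. It yields Young integrals (`exists_young`),
hence the cross integrals of the space-time path (`RoughBounds.exists_cross`), and the second level
of `∫ DF(X̃) dX̃` (`HasHolderHessian.exists_lvl2`).

Its first level is the increment of `F(X_t, t)`. Indeed, the second-order Taylor formula involves
`½ D²F (X̃¹, X̃¹)`, while the almost rough path involves `D²F X̃²`; these agree because `D²F` is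
symmetric and the symmetric part of the second level of a geometric rough path is `½ X̃¹ ⊗ X̃¹`
(`IsGeometricRoughPath.hasShuffle`, `HasShuffle.spaceTime`). This is formula (i).

For the perturbed path no second construction is needed. Formulas (ii) and (iii) are taken as the
*definition* of a candidate `Z` for `∫ DF(X̃(φ)) dX̃(φ)`. The iterated Young integrals in (iii) have
exactly the defects of additivity that make `Z` satisfy Chen's identity, and up to order
`(2 + α) / p > 1` only `D_x²F(X_s, s) (φ_t - φ_s)` and
`(D_xF ⊗ D_xF)(X_s, s) (φ_t - φ_s)` survive, which is the effect of the perturbation on the almost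
rough path (`HasHolderHessian.exists_perturbed_roughIntegral`). Uniqueness identifies `Z` with the
rough integral.
-/

namespace RoughIto

/-! ### Clocks and controlled two-parameter functions -/

/-- A clock is a continuous monotone function on `[0, T]`; its increments `H t - H s` form an
additive control. -/
structure IsClock (T : ℝ) (H : ℝ → ℝ) : Prop where
  mono : MonotoneOn H (Set.Icc 0 T)
  cont : ContinuousOn H (Set.Icc 0 T)

/-- `R s t = O((H t - H s) ^ a)` uniformly on the simplex `0 ≤ s ≤ t ≤ T`. -/
def BigO {E : Type*} [NormedAddCommGroup E] (T : ℝ) (H : ℝ → ℝ) (a : ℝ) (R : ℝ → ℝ → E) : Prop :=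
  ∃ C, 0 ≤ C ∧ ∀ s t, 0 ≤ s → s ≤ t → t ≤ T → ‖R s t‖ ≤ C * (H t - H s) ^ a

section Clock

variable {E E₁ E₂ : Type*} [NormedAddCommGroup E] [NormedAddCommGroup E₁] [NormedAddCommGroup E₂]
  {T : ℝ} {H : ℝ → ℝ} {a b : ℝ}

theorem IsClock.le (hH : IsClock T H) {s t : ℝ} (hs : 0 ≤ s) (hst : s ≤ t) (ht : t ≤ T) :
    H s ≤ H t :=
  hH.mono ⟨hs, hst.trans ht⟩ ⟨hs.trans hst, ht⟩ hst

theorem IsClock.nonneg (hH : IsClock T H) {s t : ℝ} (hs : 0 ≤ s) (hst : s ≤ t) (ht : t ≤ T) :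
    0 ≤ H t - H s :=
  sub_nonneg.2 (hH.le hs hst ht)

theorem IsClock.isControl (hH : IsClock T H) {K : ℝ} (hK : 0 ≤ K) :
    IsControl T (fun s t => K * (H t - H s)) where
  nonneg s t hs hst ht := mul_nonneg hK (hH.nonneg hs hst ht)
  continuousOn := by
    refine continuousOn_const.mul (ContinuousOn.sub ?_ ?_)
    · exact hH.cont.comp continuousOn_snd fun z hz => ⟨hz.1.trans hz.2.1, hz.2.2⟩
    · exact hH.cont.comp continuousOn_fst fun z hz => ⟨hz.1, hz.2.1.trans hz.2.2⟩
  superadd s u t _ _ _ _ := by nlinarith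
  diag t _ _ := by ring

theorem BigO.congr {R S : ℝ → ℝ → E} (hR : BigO T H a R)
    (h : ∀ s t, 0 ≤ s → s ≤ t → t ≤ T → S s t = R s t) : BigO T H a S := by
  obtain ⟨C, hC, hR⟩ := hR
  exact ⟨C, hC, fun s t hs hst ht => by rw [h s t hs hst ht]; exact hR s t hs hst ht⟩

theorem BigO.of_norm_le (hH : IsClock T H) {R : ℝ → ℝ → E} (C : ℝ)
    (h : ∀ s t, 0 ≤ s → s ≤ t → t ≤ T → ‖R s t‖ ≤ C * (H t - H s) ^ a) : BigO T H a R :=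
  ⟨max C 0, le_max_right _ _, fun s t hs hst ht => (h s t hs hst ht).trans
    (mul_le_mul_of_nonneg_right (le_max_left _ _) (Real.rpow_nonneg (hH.nonneg hs hst ht) _))⟩

theorem BigO.of_bounded {R : ℝ → ℝ → E} (C : ℝ)
    (h : ∀ s t, 0 ≤ s → s ≤ t → t ≤ T → ‖R s t‖ ≤ C) : BigO T H 0 R :=
  ⟨max C 0, le_max_right _ _, fun s t hs hst ht => by
    rw [Real.rpow_zero, mul_one]; exact (h s t hs hst ht).trans (le_max_left _ _)⟩

theorem BigO.add {R S : ℝ → ℝ → E} (hR : BigO T H a R) (hS : BigO T H a S) :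
    BigO T H a (fun s t => R s t + S s t) := by
  obtain ⟨C, hC, hR⟩ := hR
  obtain ⟨D, hD, hS⟩ := hS
  refine ⟨C + D, add_nonneg hC hD, fun s t hs hst ht => (norm_add_le _ _).trans ?_⟩
  rw [add_mul]
  exact add_le_add (hR s t hs hst ht) (hS s t hs hst ht)

theorem BigO.neg {R : ℝ → ℝ → E} (hR : BigO T H a R) : BigO T H a (fun s t => -R s t) := by
  obtain ⟨C, hC, hR⟩ := hR
  exact ⟨C, hC, fun s t hs hst ht => by rw [norm_neg]; exact hR s t hs hst ht⟩

theorem BigO.sub {R S : ℝ → ℝ → E} (hR : BigO T H a R) (hS : BigO T H a S) :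
    BigO T H a (fun s t => R s t - S s t) :=
  (hR.add hS.neg).congr fun _ _ _ _ _ => sub_eq_add_neg _ _

theorem BigO.mul_of_norm_le (hH : IsClock T H) (ha : 0 ≤ a) (hb : 0 ≤ b) (K : ℝ) {R : ℝ → ℝ → E}
    {A : ℝ → ℝ → E₁} {B : ℝ → ℝ → E₂} (hA : BigO T H a A) (hB : BigO T H b B)
    (h : ∀ s t, 0 ≤ s → s ≤ t → t ≤ T → ‖R s t‖ ≤ K * (‖A s t‖ * ‖B s t‖)) :
    BigO T H (a + b) R := by
  obtain ⟨C, hC, hA⟩ := hA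
  obtain ⟨D, hD, hB⟩ := hB
  refine BigO.of_norm_le hH (|K| * (C * D)) fun s t hs hst ht => (h s t hs hst ht).trans ?_
  rw [Real.rpow_add_of_nonneg (hH.nonneg hs hst ht) ha hb]
  have h1 := hA s t hs hst ht
  have h2 := hB s t hs hst ht
  calc K * (‖A s t‖ * ‖B s t‖) ≤ |K| * (‖A s t‖ * ‖B s t‖) :=
        mul_le_mul_of_nonneg_right (le_abs_self K) (by positivity)
    _ ≤ |K| * ((C * (H t - H s) ^ a) * (D * (H t - H s) ^ b)) :=
        mul_le_mul_of_nonneg_left (mul_le_mul h1 h2 (norm_nonneg _) ((norm_nonneg _).trans h1))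
          (abs_nonneg K)
    _ = _ := by ring

theorem BigO.of_norm_le_mul_norm (hH : IsClock T H) (ha : 0 ≤ a) (K : ℝ) {R : ℝ → ℝ → E}
    {A : ℝ → ℝ → E₁} (hA : BigO T H a A)
    (h : ∀ s t, 0 ≤ s → s ≤ t → t ≤ T → ‖R s t‖ ≤ K * ‖A s t‖) : BigO T H a R := by
  have h1 : BigO T H 0 (fun _ _ : ℝ => (1 : ℝ)) := BigO.of_bounded 1 fun _ _ _ _ _ => by simp
  have := BigO.mul_of_norm_le hH ha le_rfl K hA h1 (R := R)
    fun s t hs hst ht => by simpa using h s t hs hst ht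
  rwa [add_zero] at this

theorem BigO.weaken (hH : IsClock T H) {R : ℝ → ℝ → E} (hR : BigO T H b R) (ha : 0 ≤ a)
    (hab : a ≤ b) : BigO T H a R := by
  obtain ⟨C, hC, hR⟩ := hR
  refine ⟨C * |H T - H 0| ^ (b - a), by positivity,
    fun s t hs hst ht => (hR s t hs hst ht).trans ?_⟩
  have h0 := hH.nonneg hs hst ht
  have h1 : H t - H s ≤ |H T - H 0| := by
    have := hH.le le_rfl hs (hst.trans ht)
    have := hH.le (hs.trans hst) ht le_rfl
    exact le_trans (by linarith) (le_abs_self _)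
  have h2 : (H t - H s) ^ b = (H t - H s) ^ (b - a) * (H t - H s) ^ a := by
    rw [← Real.rpow_add_of_nonneg h0 (by linarith) ha]; congr 1; ring
  rw [h2, ← mul_assoc]
  gcongr

/-- Finitely many constants can be absorbed in the control: a function of order `θ` is bounded
by `(K (H t - H s)) ^ θ` for all large `K`. -/
theorem BigO.exists_le (hH : IsClock T H) {R : ℝ → ℝ → E} {θ : ℝ} (hθ : 0 < θ)
    (hR : BigO T H θ R) : ∃ K₀, 0 ≤ K₀ ∧ ∀ K, K₀ ≤ K → ∀ s t, 0 ≤ s → s ≤ t → t ≤ T →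
      ‖R s t‖ ≤ (K * (H t - H s)) ^ θ := by
  obtain ⟨C, hC, hR⟩ := hR
  refine ⟨C ^ (1 / θ), Real.rpow_nonneg hC _, fun K hK s t hs hst ht =>
    (hR s t hs hst ht).trans ?_⟩
  have hK0 : 0 ≤ K := (Real.rpow_nonneg hC _).trans hK
  have h0 := hH.nonneg hs hst ht
  rw [Real.mul_rpow hK0 h0]
  gcongr
  calc C = (C ^ (1 / θ)) ^ θ := by rw [← Real.rpow_mul hC, one_div_mul_cancel hθ.ne', Real.rpow_one]
    _ ≤ K ^ θ := Real.rpow_le_rpow (Real.rpow_nonneg hC _) hK hθ.le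

end Clock

/-! ### Controls on partitions of small mesh -/

section Mesh

theorem le_of_step_le {n : ℕ} {a : ℕ → ℝ} (h : ∀ i < n, a i ≤ a (i + 1)) {i j : ℕ} (hij : i ≤ j)
    (hj : j ≤ n) : a i ≤ a j := by
  induction j, hij using Nat.le_induction with
  | base => exact le_rfl
  | succ k _ ih => exact (ih (by omega)).trans (h k (by omega))

variable {T : ℝ} {ω : ℝ → ℝ → ℝ}

theorem IsControl.sum_le (hω : IsControl T ω) {n : ℕ} {a : ℕ → ℝ} (h : ∀ i < n, a i ≤ a (i + 1))
    (h0 : 0 ≤ a 0) (hn : a n ≤ T) :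
    ∑ i ∈ Finset.range n, ω (a i) (a (i + 1)) ≤ ω (a 0) (a n) := by
  have key : ∀ k ≤ n, ∑ i ∈ Finset.range k, ω (a i) (a (i + 1)) ≤ ω (a 0) (a k) := by
    intro k
    induction k with
    | zero =>
      intro _
      rw [Finset.sum_range_zero, hω.diag _ h0 ((le_of_step_le h (Nat.zero_le n) le_rfl).trans hn)]
    | succ k ih =>
      intro hk
      rw [Finset.sum_range_succ]
      have := hω.superadd (a 0) (a k) (a (k + 1)) h0 (le_of_step_le h (Nat.zero_le k) (by omega))
        (h k (by omega)) ((le_of_step_le h hk le_rfl).trans hn)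
      linarith [ih (by omega)]
  exact key n le_rfl

theorem isCompact_simplex (T : ℝ) : IsCompact (simplex T) := by
  have hsub : simplex T ⊆ Set.Icc 0 T ×ˢ Set.Icc 0 T := fun z hz =>
    ⟨⟨hz.1, hz.2.1.trans hz.2.2⟩, ⟨hz.1.trans hz.2.1, hz.2.2⟩⟩
  refine (isCompact_Icc.prod isCompact_Icc).of_isClosed_subset ?_ hsub
  exact (isClosed_le continuous_const continuous_fst).inter
    ((isClosed_le continuous_fst continuous_snd).inter
      (isClosed_le continuous_snd continuous_const))

/-- A continuous function on the simplex is uniformly continuous, in terms of coordinates. -/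
theorem exists_delta_of_continuousOn_simplex {w : ℝ → ℝ → ℝ}
    (hw : ContinuousOn (fun z : ℝ × ℝ => w z.1 z.2) (simplex T)) {ε : ℝ} (hε : 0 < ε) :
    ∃ δ > 0, ∀ s t s' t', 0 ≤ s → s ≤ t → t ≤ T → 0 ≤ s' → s' ≤ t' → t' ≤ T →
      |s - s'| < δ → |t - t'| < δ → |w s t - w s' t'| < ε := by
  have hu := (isCompact_simplex T).uniformContinuousOn_of_continuous hw
  obtain ⟨δ, hδ, h⟩ := Metric.uniformContinuousOn_iff.1 hu ε hε
  refine ⟨δ, hδ, fun s t s' t' hs hst ht hs' hst' ht' h1 h2 => ?_⟩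
  have := h (s, t) ⟨hs, hst, ht⟩ (s', t') ⟨hs', hst', ht'⟩
    (by rw [Prod.dist_eq]; exact max_lt h1 h2)
  simpa [Real.dist_eq] using this

/-- For `θ > 1` the sums `∑ ω (t_l, t_{l+1}) ^ θ` tend to `0` with the mesh. -/
theorem IsControl.exists_mesh (hω : IsControl T ω) {θ : ℝ} (hθ : 1 < θ) {s t : ℝ} (hs : 0 ≤ s)
    (hst : s ≤ t) (ht : t ≤ T) {ε : ℝ} (hε : 0 < ε) :
    ∃ δ > 0, ∀ (n : ℕ) (a : ℕ → ℝ), a 0 = s → a n = t → (∀ i < n, a i ≤ a (i + 1)) →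
      (∀ i < n, a (i + 1) - a i < δ) →
      ∑ i ∈ Finset.range n, ω (a i) (a (i + 1)) ^ θ ≤ ε := by
  have hω0 := hω.nonneg s t hs hst ht
  set η : ℝ := (ε / (ω s t + 1)) ^ (1 / (θ - 1)) with hη
  have hq : 0 < ε / (ω s t + 1) := by positivity
  have hη0 : 0 < η := Real.rpow_pos_of_pos hq _
  have hηθ : η ^ (θ - 1) = ε / (ω s t + 1) := by
    rw [hη, ← Real.rpow_mul hq.le, one_div_mul_cancel (by linarith), Real.rpow_one]
  obtain ⟨δ, hδ, hmod⟩ := exists_delta_of_continuousOn_simplex hω.continuousOn hη0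
  refine ⟨δ, hδ, fun n a ha0 han hmono hmesh => ?_⟩
  have hin : ∀ i ≤ n, 0 ≤ a i ∧ a i ≤ T := fun i hi =>
    ⟨by rw [← ha0] at hs; exact hs.trans (le_of_step_le hmono (Nat.zero_le i) hi),
     by rw [← han] at ht; exact (le_of_step_le hmono hi le_rfl).trans ht⟩
  have hterm : ∀ i ∈ Finset.range n,
      ω (a i) (a (i + 1)) ^ θ ≤ η ^ (θ - 1) * ω (a i) (a (i + 1)) := by
    intro i hi
    have hi := Finset.mem_range.1 hi
    have h0 := (hin i hi.le).1
    have h1 := (hin (i + 1) hi).2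
    have hnn := hω.nonneg _ _ h0 (hmono i hi) h1
    have hle : ω (a i) (a (i + 1)) ≤ η := by
      have := hmod (a i) (a (i + 1)) (a i) (a i) h0 (hmono i hi) h1 h0 le_rfl
        ((hmono i hi).trans h1) (by simpa using hδ)
        (by rw [abs_of_nonneg (sub_nonneg.2 (hmono i hi))]; exact hmesh i hi)
      rw [hω.diag _ h0 ((hmono i hi).trans h1), sub_zero, abs_of_nonneg hnn] at this
      exact this.le
    have : ω (a i) (a (i + 1)) ^ θ
        = ω (a i) (a (i + 1)) ^ (θ - 1) * ω (a i) (a (i + 1)) := by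
      rw [← Real.rpow_add_one' hnn (by linarith)]; congr 1; ring
    rw [this]
    gcongr
  calc ∑ i ∈ Finset.range n, ω (a i) (a (i + 1)) ^ θ
      ≤ η ^ (θ - 1) * ∑ i ∈ Finset.range n, ω (a i) (a (i + 1)) := by
        rw [Finset.mul_sum]; exact Finset.sum_le_sum hterm
    _ ≤ η ^ (θ - 1) * ω s t := by
        gcongr
        have := hω.sum_le hmono (by rw [ha0]; exact hs) (by rw [han]; exact ht)
        rwa [ha0, han] at this
    _ ≤ ε := by
        rw [hηθ, div_mul_eq_mul_div, div_le_iff₀ (by positivity)]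
        nlinarith

/-- The points `s + i (t - s) / (n + 1)`. -/
noncomputable def uniformGrid (s t : ℝ) (n i : ℕ) : ℝ := s + i * ((t - s) / (n + 1))

theorem uniformGrid_zero (s t : ℝ) (n : ℕ) : uniformGrid s t n 0 = s := by simp [uniformGrid]

theorem uniformGrid_last (s t : ℝ) (n : ℕ) : uniformGrid s t n (n + 1) = t := by
  have : (n : ℝ) + 1 ≠ 0 := by positivity
  simp only [uniformGrid]; push_cast; field_simp; ring

theorem uniformGrid_succ_sub (s t : ℝ) (n i : ℕ) :
    uniformGrid s t n (i + 1) - uniformGrid s t n i = (t - s) / (n + 1) := by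
  simp only [uniformGrid]; push_cast; ring

theorem uniformGrid_le_succ {s t : ℝ} (hst : s ≤ t) (n i : ℕ) :
    uniformGrid s t n i ≤ uniformGrid s t n (i + 1) := by
  have h := uniformGrid_succ_sub s t n i
  have : 0 ≤ (t - s) / (n + 1) := div_nonneg (sub_nonneg.2 hst) (by positivity)
  linarith

theorem eventually_div_lt (c : ℝ) {δ : ℝ} (hδ : 0 < δ) :
    ∀ᶠ n : ℕ in Filter.atTop, c / ((n : ℝ) + 1) < δ := by
  have : Filter.Tendsto (fun n : ℕ => c / ((n : ℝ) + 1)) Filter.atTop (nhds 0) :=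
    (tendsto_const_div_atTop_nhds_zero_nat c).comp (Filter.tendsto_add_atTop_nat 1) |>.congr
      (by intro n; simp)
  exact this.eventually (gt_mem_nhds hδ)

/-- An additive function on the simplex of order `θ > 1` vanishes. -/
theorem eq_zero_of_additive {E : Type*} [NormedAddCommGroup E] {ω' : ℝ → ℝ → ℝ} {θ θ' : ℝ}
    (hω : IsControl T ω) (hω' : IsControl T ω') (hθ : 1 < θ) (hθ' : 1 < θ') {D : ℝ → ℝ → E}
    (hadd : ∀ s u t, 0 ≤ s → s ≤ u → u ≤ t → t ≤ T → D s t = D s u + D u t)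
    (hD : ∀ s t, 0 ≤ s → s ≤ t → t ≤ T → ‖D s t‖ ≤ ω s t ^ θ + ω' s t ^ θ') {s t : ℝ} (hs : 0 ≤ s)
    (hst : s ≤ t) (ht : t ≤ T) : D s t = 0 := by
  rw [← norm_le_zero_iff]
  refine le_of_forall_pos_le_add fun ε hε => ?_
  obtain ⟨δ, hδ, h1⟩ := hω.exists_mesh hθ hs hst ht (half_pos hε)
  obtain ⟨δ', hδ', h2⟩ := hω'.exists_mesh hθ' hs hst ht (half_pos hε)
  obtain ⟨n, hn, hn'⟩ := ((eventually_div_lt (t - s) hδ).and (eventually_div_lt (t - s) hδ')).exists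
  set a := uniformGrid s t n with ha
  have hmono : ∀ i < n + 1, a i ≤ a (i + 1) := fun i _ => uniformGrid_le_succ hst n i
  have ha0 : a 0 = s := uniformGrid_zero s t n
  have han : a (n + 1) = t := uniformGrid_last s t n
  have hin : ∀ i ≤ n + 1, 0 ≤ a i ∧ a i ≤ T := fun i hi =>
    ⟨by rw [← ha0] at hs; exact hs.trans (le_of_step_le hmono (Nat.zero_le i) hi),
     by rw [← han] at ht; exact (le_of_step_le hmono hi le_rfl).trans ht⟩
  have hsum : ∀ k ≤ n + 1, D (a 0) (a k) = ∑ i ∈ Finset.range k, D (a i) (a (i + 1)) := by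
    intro k
    induction k with
    | zero =>
      intro _
      have := hadd (a 0) (a 0) (a 0) (hin 0 (by omega)).1 le_rfl le_rfl (hin 0 (by omega)).2
      simpa using this
    | succ k ih =>
      intro hk
      rw [Finset.sum_range_succ, ← ih (by omega)]
      exact hadd _ _ _ (hin 0 (by omega)).1 (le_of_step_le hmono (Nat.zero_le k) (by omega))
        (hmono k (by omega)) (hin _ hk).2
  have e1 := h1 (n + 1) a ha0 han hmono
    (fun i _ => by rw [ha, uniformGrid_succ_sub]; exact hn)
  have e2 := h2 (n + 1) a ha0 han hmono
    (fun i _ => by rw [ha, uniformGrid_succ_sub]; exact hn')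
  have := hsum (n + 1) le_rfl
  rw [ha0, han] at this
  rw [this]
  calc ‖∑ i ∈ Finset.range (n + 1), D (a i) (a (i + 1))‖
      ≤ ∑ i ∈ Finset.range (n + 1), (ω (a i) (a (i + 1)) ^ θ + ω' (a i) (a (i + 1)) ^ θ') :=
        norm_sum_le_of_le _ fun i hi => by
          have hi := Finset.mem_range.1 hi
          exact hD _ _ (hin i hi.le).1 (hmono i hi) (hin _ hi).2
    _ ≤ 0 + ε := by rw [Finset.sum_add_distrib]; linarith

end Mesh

/-! ### The sewing lemma -/

section Sewing

variable {E : Type*} [NormedAddCommGroup E] {T : ℝ} {H : ℝ → ℝ}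

/-- Young's maximal inequality. An interval of the partition is split off around the middle of the
total mass of the control, so that each of the two remaining pieces carries at most half of it; the
constant then reproduces itself because `2 * 2 ^ (-θ) < 1`. -/
theorem exists_forall_norm_sub_sum_le (hH : IsClock T H) {θ : ℝ} (hθ : 1 < θ) {K : ℝ} (hK : 0 ≤ K)
    {Ξ : ℝ → ℝ → E} (hΞ : ∀ s u t, 0 ≤ s → s ≤ u → u ≤ t → t ≤ T →
      ‖Ξ s t - Ξ s u - Ξ u t‖ ≤ K * (H t - H s) ^ θ) :
    ∃ C, 0 ≤ C ∧ ∀ a : ℕ → ℝ, Monotone a → (∀ i, a i ∈ Set.Icc 0 T) → ∀ m j,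
      ‖Ξ (a j) (a (j + m)) - ∑ i ∈ Finset.range m, Ξ (a (j + i)) (a (j + i + 1))‖
        ≤ C * (H (a (j + m)) - H (a j)) ^ θ := by
  set c : ℝ := 2 * (1 / 2 : ℝ) ^ θ with hc
  have hc1 : c < 1 := by
    have : (1 / 2 : ℝ) ^ θ < (1 / 2 : ℝ) ^ (1 : ℝ) :=
      Real.rpow_lt_rpow_of_exponent_gt (by norm_num) (by norm_num) hθ
    rw [Real.rpow_one] at this
    linarith
  have hC : 0 ≤ 2 * K / (1 - c) := div_nonneg (by linarith) (by linarith)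
  have hCeq : 2 * K / (1 - c) * c + 2 * K = 2 * K / (1 - c) := by
    have : 1 - c ≠ 0 := by linarith
    field_simp; ring
  refine ⟨2 * K / (1 - c), hC, fun a ha hin m => ?_⟩
  set C := 2 * K / (1 - c)
  induction m using Nat.strong_induction_on with
  | _ m ih =>
  intro j
  have hHa : ∀ {i k}, i ≤ k → H (a i) ≤ H (a k) := fun h => hH.mono (hin _) (hin _) (ha h)
  rcases Nat.eq_zero_or_pos m with rfl | hm
  · have := hΞ (a j) (a j) (a j) (hin j).1 le_rfl le_rfl (hin j).2
    simpa [Real.zero_rpow (by linarith : θ ≠ 0)] using this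
  set w := H (a (j + m)) - H (a j) with hw
  have hw0 : 0 ≤ w := sub_nonneg.2 (hHa (by omega))
  set L := (H (a j) + H (a (j + m))) / 2 with hL
  set i := Nat.findGreatest (fun i => H (a (j + i)) ≤ L) (m - 1) with hi
  have him : i < m := by
    have := Nat.findGreatest_le (P := fun i => H (a (j + i)) ≤ L) (m - 1)
    omega
  have hiL : H (a (j + i)) ≤ L :=
    Nat.findGreatest_spec (P := fun i => H (a (j + i)) ≤ L) (Nat.zero_le (m - 1))
      (by have := hHa (show j ≤ j + m by omega); simp only [hL, add_zero]; linarith)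
  have hiL' : L ≤ H (a (j + i + 1)) := by
    rcases Nat.lt_or_ge (i + 1) m with h | h
    · exact le_of_not_ge (Nat.findGreatest_is_greatest (P := fun i => H (a (j + i)) ≤ L)
        (Nat.lt_succ_self i) (show i + 1 ≤ m - 1 by omega))
    · have : j + i + 1 = j + m := by omega
      rw [this]
      have := hHa (show j ≤ j + m by omega); linarith
  obtain ⟨m', hm'⟩ : ∃ m', m = i + 1 + m' := ⟨m - (i + 1), by omega⟩
  have e1 := ih i him j
  have e2 := ih m' (by omega) (j + (i + 1))
  have hend : j + (i + 1) + m' = j + m := by omega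
  rw [hend] at e2
  have hsum : ∑ k ∈ Finset.range m, Ξ (a (j + k)) (a (j + k + 1))
      = ∑ k ∈ Finset.range i, Ξ (a (j + k)) (a (j + k + 1)) + Ξ (a (j + i)) (a (j + (i + 1)))
        + ∑ k ∈ Finset.range m', Ξ (a (j + (i + 1) + k)) (a (j + (i + 1) + k + 1)) := by
    rw [hm', Finset.sum_range_add, Finset.sum_range_succ]
    simp only [add_assoc]
  have half : ∀ x, 0 ≤ x → x ≤ w / 2 → C * x ^ θ ≤ C * ((1 / 2 : ℝ) ^ θ * w ^ θ) := by
    intro x hx hxw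
    rw [← Real.mul_rpow (by norm_num) hw0]
    have : x ≤ 1 / 2 * w := by linarith
    gcongr
  have b1 := e1.trans (half _ (sub_nonneg.2 (hHa (by omega))) (by simp only [hw]; linarith))
  have b2 := e2.trans (half _ (sub_nonneg.2 (hHa (by omega)))
    (by rw [← add_assoc]; simp only [hw]; linarith))
  have d1 := hΞ (a j) (a (j + i)) (a (j + m)) (hin _).1 (ha (by omega)) (ha (by omega)) (hin _).2
  have d2 := hΞ (a (j + i)) (a (j + (i + 1))) (a (j + m)) (hin _).1 (ha (by omega))
    (ha (by omega)) (hin _).2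
  have d2' : K * (H (a (j + m)) - H (a (j + i))) ^ θ ≤ K * w ^ θ := by
    have h1 := hHa (show j ≤ j + i by omega)
    have h2 := hHa (show j + i ≤ j + m by omega)
    have : H (a (j + m)) - H (a (j + i)) ≤ w := by simp only [hw]; linarith
    gcongr
  have hsplit : Ξ (a j) (a (j + m)) - ∑ k ∈ Finset.range m, Ξ (a (j + k)) (a (j + k + 1))
      = (Ξ (a j) (a (j + m)) - Ξ (a j) (a (j + i)) - Ξ (a (j + i)) (a (j + m)))
        + (Ξ (a (j + i)) (a (j + m)) - Ξ (a (j + i)) (a (j + (i + 1)))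
            - Ξ (a (j + (i + 1))) (a (j + m)))
        + (Ξ (a j) (a (j + i)) - ∑ k ∈ Finset.range i, Ξ (a (j + k)) (a (j + k + 1)))
        + (Ξ (a (j + (i + 1))) (a (j + m))
            - ∑ k ∈ Finset.range m', Ξ (a (j + (i + 1) + k)) (a (j + (i + 1) + k + 1))) := by
    rw [hsum]; abel
  rw [hsplit]
  refine (norm_add₄_le).trans ?_
  have : C * w ^ θ = 2 * (C * ((1 / 2 : ℝ) ^ θ * w ^ θ)) + 2 * (K * w ^ θ) := by
    conv_lhs => rw [← hCeq]
    rw [hc]; ring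
  linarith

/-- **Sewing lemma.** A two-parameter function that is additive up to an error of order `θ > 1` is
the increment of a path up to an error of the same order. The path is an ultrafilter limit of sums
over uniform grids. -/
theorem exists_sewing [NormedSpace ℝ E] [FiniteDimensional ℝ E] (hT : 0 ≤ T) (hH : IsClock T H)
    {θ : ℝ} (hθ : 1 < θ) {K : ℝ} (hK : 0 ≤ K) {Ξ : ℝ → ℝ → E}
    (hΞ : ∀ s u t, 0 ≤ s → s ≤ u → u ≤ t → t ≤ T →
      ‖Ξ s t - Ξ s u - Ξ u t‖ ≤ K * (H t - H s) ^ θ) :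
    ∃ J : ℝ → E, BigO T H θ (fun s t => J t - J s - Ξ s t) := by
  obtain ⟨C, hC, hmax⟩ := exists_forall_norm_sub_sum_le hH hθ hK hΞ
  have hproper : ProperSpace E := FiniteDimensional.proper ℝ E
  have hdiag : ∀ t, 0 ≤ t → t ≤ T → Ξ t t = 0 := fun t h0 h1 => by
    have := hΞ t t t h0 le_rfl le_rfl h1
    simpa [Real.zero_rpow (by linarith : θ ≠ 0)] using this
  -- the grid of `[0, T]`, clamped to `[s, t]`
  set a : ℝ → ℝ → ℕ → ℕ → ℝ := fun s t n i => max s (min t (uniformGrid 0 T n i)) with ha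
  have hgrid : ∀ n, Monotone (uniformGrid 0 T n) := fun n =>
    monotone_nat_of_le_succ fun i => uniformGrid_le_succ hT n i
  have ha_mono : ∀ s t n, Monotone (a s t n) := fun s t n i j hij =>
    max_le_max le_rfl (min_le_min le_rfl (hgrid n hij))
  have ha_mem : ∀ {s t}, s ≤ t → ∀ n i, s ≤ a s t n i ∧ a s t n i ≤ t := fun hst n i =>
    ⟨le_max_left _ _, max_le hst (min_le_left _ _)⟩
  have ha_zero : ∀ {s t}, 0 ≤ s → s ≤ t → ∀ n, a s t n 0 = s := fun hs hst n => by
    simp only [ha, uniformGrid_zero]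
    rw [min_eq_right (hs.trans hst), max_eq_left hs]
  have ha_last : ∀ {s t}, s ≤ t → t ≤ T → ∀ n, a s t n (n + 1) = t := fun hst ht n => by
    simp only [ha, uniformGrid_last]
    rw [min_eq_left ht, max_eq_right hst]
  set S : ℝ → ℝ → ℕ → E := fun s t n =>
    ∑ i ∈ Finset.range (n + 1), Ξ (a s t n i) (a s t n (i + 1)) with hS
  have hSbound : ∀ s t, 0 ≤ s → s ≤ t → t ≤ T → ∀ n,
      ‖S s t n - Ξ s t‖ ≤ C * (H t - H s) ^ θ := by
    intro s t hs hst ht n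
    have := hmax (a s t n) (ha_mono s t n)
      (fun i => ⟨hs.trans (ha_mem hst n i).1, (ha_mem hst n i).2.trans ht⟩) (n + 1) 0
    simp only [zero_add] at this
    rw [ha_zero hs hst, ha_last hst ht] at this
    rw [norm_sub_rev]
    exact this
  have hlim : ∀ s t, 0 ≤ s → s ≤ t → t ≤ T → ∃ x : E, ‖x - Ξ s t‖ ≤ C * (H t - H s) ^ θ ∧
      Filter.Tendsto (S s t) (Filter.hyperfilter ℕ) (nhds x) := by
    intro s t hs hst ht
    have hcomp := isCompact_closedBall (Ξ s t) (C * (H t - H s) ^ θ)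
    obtain ⟨x, hx, hle⟩ := hcomp.ultrafilter_le_nhds ((Filter.hyperfilter ℕ).map (S s t)) (by
      rw [Filter.le_principal_iff, Ultrafilter.mem_coe, Ultrafilter.mem_map]
      exact Filter.univ_mem' fun n => by
        simpa [dist_eq_norm] using hSbound s t hs hst ht n)
    exact ⟨x, by simpa [dist_eq_norm] using hx, hle⟩
  choose! I hIb hIl using hlim
  -- a grid interval that contains `u` in its interior contributes to the defect of additivity
  have hcell : ∀ x y u, 0 ≤ x → x ≤ y → y ≤ T → 0 ≤ u → u ≤ T →
      ‖Ξ (min x u) (min y u) + Ξ (max x u) (max y u) - Ξ x y‖ ≤ K * (H y - H x) ^ θ := by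
    intro x y u hx hxy hy hu huT
    have h0 : 0 ≤ K * (H y - H x) ^ θ := mul_nonneg hK (Real.rpow_nonneg (hH.nonneg hx hxy hy) _)
    rcases le_total y u with h | h
    · rw [min_eq_left (hxy.trans h), min_eq_left h, max_eq_right (hxy.trans h), max_eq_right h,
        hdiag u hu huT]
      simpa using h0
    rcases le_total u x with h' | h'
    · rw [min_eq_right h', min_eq_right h, max_eq_left h', max_eq_left h, hdiag u hu huT]
      simpa using h0
    · rw [min_eq_left h', min_eq_right h, max_eq_right h', max_eq_left h, norm_sub_rev, ← sub_sub]
      exact hΞ x u y hx h' h hy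
  have hadd : ∀ s u t, 0 ≤ s → s ≤ u → u ≤ t → t ≤ T → I s u + I u t = I s t := by
    intro s u t hs hsu hut ht
    have hst := hsu.trans hut
    have hdefect : ∀ n, ‖S s u n + S u t n - S s t n‖ ≤
        K * ∑ i ∈ Finset.range (n + 1), (1 * (H (a s t n (i + 1)) - H (a s t n i))) ^ θ := by
      intro n
      simp only [hS]
      rw [← Finset.sum_add_distrib, ← Finset.sum_sub_distrib, Finset.mul_sum]
      refine norm_sum_le_of_le _ fun i _ => ?_
      have e1 : ∀ i, a s u n i = min (a s t n i) u := fun i => by simp only [ha]; grind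
      have e2 : ∀ i, a u t n i = max (a s t n i) u := fun i => by simp only [ha]; grind
      rw [e1, e1, e2, e2, one_mul]
      exact hcell _ _ _ (hs.trans (ha_mem hst n i).1) (ha_mono s t n (Nat.le_succ i))
        ((ha_mem hst n _).2.trans ht) (hs.trans hsu) (hut.trans ht)
    have hzero : Filter.Tendsto (fun n => S s u n + S u t n - S s t n) Filter.atTop (nhds 0) := by
      rw [tendsto_zero_iff_norm_tendsto_zero, Metric.tendsto_nhds]
      intro ε hε
      obtain ⟨δ, hδ, hm⟩ := (hH.isControl zero_le_one).exists_mesh hθ hs hst ht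
        (show 0 < ε / (K + 1) by positivity)
      filter_upwards [eventually_div_lt (T - 0) hδ] with n hn
      have hsmall := hm (n + 1) (a s t n) (ha_zero hs hst n) (ha_last hst ht n)
        (fun i _ => ha_mono s t n (Nat.le_succ i)) (fun i _ => by
          have h1 := uniformGrid_succ_sub 0 T n i
          have h2 := hgrid n (Nat.le_succ i)
          simp only [Nat.succ_eq_add_one] at h2
          simp only [ha]
          grind)
      have h1 := hdefect n
      rw [dist_zero_right, norm_norm]
      calc _ ≤ K * (ε / (K + 1)) := h1.trans (mul_le_mul_of_nonneg_left hsmall hK)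
        _ < ε := by
          rw [mul_div_assoc', div_lt_iff₀ (by positivity)]; nlinarith
    have hl := ((hIl s u hs hsu (hut.trans ht)).add (hIl u t (hs.trans hsu) hut ht)).sub
      (hIl s t hs hst ht)
    exact sub_eq_zero.1 (tendsto_nhds_unique hl (hzero.mono_left Nat.hyperfilter_le_atTop))
  refine ⟨fun t => I 0 t, C, hC, fun s t hs hst ht => ?_⟩
  have : I 0 t - I 0 s = I s t := by rw [← hadd 0 s t le_rfl hs hst ht, add_sub_cancel_left]
  simp only [this]
  exact hIb s t hs hst ht

end Sewing

/-! ### Variation bounds and Young integrals -/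

section Young

variable {E G C : Type*} [NormedAddCommGroup E] [NormedAddCommGroup G] [NormedSpace ℝ G]
  [NormedAddCommGroup C] [NormedSpace ℝ C] {T : ℝ} {H : ℝ → ℝ} {a b : ℝ}

theorem IntervalPartition.first_le {s t : ℝ} (D : IntervalPartition s t) {i : ℕ} (hi : i ≤ D.n) :
    s ≤ D.pt i := by
  conv_lhs => rw [← D.first]
  exact le_of_step_le (fun i hi => (D.lt i hi).le) (Nat.zero_le i) hi

theorem IntervalPartition.le_last {s t : ℝ} (D : IntervalPartition s t) {i : ℕ} (hi : i ≤ D.n) :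
    D.pt i ≤ t := by
  conv_rhs => rw [← D.last]
  exact le_of_step_le (fun i hi => (D.lt i hi).le) hi le_rfl

theorem BigO.hasFinitePVar (hH : IsClock T H) (ha : 0 < a) {Z : ℝ → ℝ → E} (hZ : BigO T H a Z)
    {s t : ℝ} (hs : 0 ≤ s) (ht : t ≤ T) : HasFinitePVar (1 / a) s t Z := by
  obtain ⟨K, hK, hZ⟩ := hZ
  have hK' : 0 ≤ K ^ (1 / a) := Real.rpow_nonneg hK _
  refine lt_of_le_of_lt (iSup_le fun D => ?_)
    (ENNReal.ofReal_lt_top (r := K ^ (1 / a) * (H t - H s)))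
  have hterm : ∀ i ∈ Finset.range D.n, ‖Z (D.pt i) (D.pt (i + 1))‖ₑ ^ (1 / a)
      ≤ ENNReal.ofReal (K ^ (1 / a) * (H (D.pt (i + 1)) - H (D.pt i))) := by
    intro i hi
    have hi := Finset.mem_range.1 hi
    have h0 := hs.trans (D.first_le hi.le)
    have h1 := (D.le_last (i := i + 1) hi).trans ht
    have hle := (D.lt i hi).le
    have hnn := hH.nonneg h0 hle h1
    rw [← ofReal_norm, ENNReal.ofReal_rpow_of_nonneg (norm_nonneg _) (by positivity)]
    refine ENNReal.ofReal_le_ofReal ?_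
    calc ‖Z (D.pt i) (D.pt (i + 1))‖ ^ (1 / a)
        ≤ (K * (H (D.pt (i + 1)) - H (D.pt i)) ^ a) ^ (1 / a) :=
          Real.rpow_le_rpow (norm_nonneg _) (hZ _ _ h0 hle h1) (by positivity)
      _ = _ := by
          rw [Real.mul_rpow hK (Real.rpow_nonneg hnn _), ← Real.rpow_mul hnn,
            mul_one_div_cancel ha.ne', Real.rpow_one]
  refine (Finset.sum_le_sum hterm).trans ?_
  rw [← ENNReal.ofReal_sum_of_nonneg fun i hi => ?_]
  · refine ENNReal.ofReal_le_ofReal ?_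
    have := (hH.isControl hK').sum_le (fun i hi => (D.lt i hi).le) (by rw [D.first]; exact hs)
      (by rw [D.last]; exact ht)
    rwa [D.first, D.last] at this
  · have hi := Finset.mem_range.1 hi
    exact mul_nonneg hK' (hH.nonneg (hs.trans (D.first_le hi.le)) (D.lt i hi).le
      ((D.le_last (i := i + 1) hi).trans ht))

/-- A path with increments of positive order is continuous. -/
theorem BigO.continuousOn (hH : IsClock T H) (ha : 0 < a) {g : ℝ → E}
    (hg : BigO T H a (incr g)) : ContinuousOn g (Set.Icc 0 T) := by
  obtain ⟨K, hK, hg⟩ := hg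
  have hsym : ∀ s ∈ Set.Icc 0 T, ∀ t ∈ Set.Icc 0 T, ‖g t - g s‖ ≤ K * |H t - H s| ^ a := by
    intro s hs t ht
    rcases le_total s t with h | h
    · rw [abs_of_nonneg (hH.nonneg hs.1 h ht.2)]; exact hg s t hs.1 h ht.2
    · rw [norm_sub_rev, abs_sub_comm, abs_of_nonneg (hH.nonneg ht.1 h hs.2)]
      exact hg t s ht.1 h hs.2
  intro s hs
  have hlim : Filter.Tendsto (fun t => K * |H t - H s| ^ a) (nhdsWithin s (Set.Icc 0 T))
      (nhds 0) := by
    have h1 : Filter.Tendsto (fun t => |H t - H s|) (nhdsWithin s (Set.Icc 0 T)) (nhds 0) := by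
      have := ((hH.cont s hs).sub_const (H s)).abs
      simpa using this
    have h2 := (h1.rpow_const (p := a) (Or.inr ha.le)).const_mul K
    simpa [Real.zero_rpow ha.ne'] using h2
  rw [ContinuousWithinAt, tendsto_iff_norm_sub_tendsto_zero]
  exact squeeze_zero' (Filter.Eventually.of_forall fun _ => norm_nonneg _)
    (eventually_nhdsWithin_of_forall fun t ht => hsym s hs t ht) hlim

/-- Partitions of arbitrarily small mesh exist. -/
theorem exists_partition {s t : ℝ} (hst : s ≤ t) {δ : ℝ} (hδ : 0 < δ) :
    ∃ D : IntervalPartition s t, ∀ i < D.n, D.pt (i + 1) - D.pt i < δ := by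
  rcases hst.eq_or_lt with rfl | hlt
  · exact ⟨⟨0, fun _ => s, rfl, rfl, by simp⟩, by simp⟩
  · obtain ⟨n, hn⟩ := (eventually_div_lt (t - s) hδ).exists
    refine ⟨⟨n + 1, uniformGrid s t n, uniformGrid_zero s t n, uniformGrid_last s t n,
      fun i _ => ?_⟩, fun i _ => by simpa [uniformGrid_succ_sub] using hn⟩
    have h := uniformGrid_succ_sub s t n i
    have : 0 < (t - s) / (n + 1) := div_pos (sub_pos.2 hlt) (by positivity)
    linarith

theorem IsRSLimit.unique {f : ℝ → G →L[ℝ] C} {g : ℝ → G} {s t : ℝ} (hst : s ≤ t) {I J : C}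
    (hI : IsRSLimit f g s t I) (hJ : IsRSLimit f g s t J) : I = J := by
  rw [← sub_eq_zero, ← norm_le_zero_iff]
  refine le_of_forall_pos_le_add fun ε hε => ?_
  obtain ⟨δ, hδ, h1⟩ := hI (ε / 2) (half_pos hε)
  obtain ⟨δ', hδ', h2⟩ := hJ (ε / 2) (half_pos hε)
  obtain ⟨D, hD⟩ := exists_partition hst (lt_min hδ hδ')
  have htag : ∀ i < D.n, D.pt i ≤ D.pt i ∧ D.pt i ≤ D.pt (i + 1) := fun i hi =>
    ⟨le_rfl, (D.lt i hi).le⟩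
  have e1 := h1 D D.pt (fun i hi => (hD i hi).trans_le (min_le_left _ _)) htag
  have e2 := h2 D D.pt (fun i hi => (hD i hi).trans_le (min_le_right _ _)) htag
  set S := ∑ i ∈ Finset.range D.n, f (D.pt i) (g (D.pt (i + 1)) - g (D.pt i))
  calc ‖I - J‖ = ‖(S - J) - (S - I)‖ := by congr 1; abel
    _ ≤ ‖S - J‖ + ‖S - I‖ := norm_sub_le _ _
    _ ≤ 0 + ε := by linarith

theorem HasYoungIntegral.youngIntegral_eq {f : ℝ → G →L[ℝ] C} {g : ℝ → G} {s t : ℝ}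
    (hst : s ≤ t) {I : C} (h : HasYoungIntegral f g s t I) : youngIntegral f g s t = I := by
  have hex : YoungIntegrable f g s t := ⟨I, h⟩
  rw [youngIntegral, dif_pos hex]
  exact hex.choose_spec.limit.unique hst h.limit

/-- The Young integral over `[s, t]` depends only on the values of the integrand on `[s, t]`. -/
theorem HasYoungIntegral.congr {f f' : ℝ → G →L[ℝ] C} {g : ℝ → G} {s t : ℝ} {I : C}
    (h : HasYoungIntegral f g s t I) (hf : ∀ u, s ≤ u → u ≤ t → f' u = f u) :
    HasYoungIntegral f' g s t I where
  continuousOn_left := h.continuousOn_left.congr fun u hu => hf u hu.1 hu.2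
  continuousOn_right := h.continuousOn_right
  variation := by
    obtain ⟨r, q, hr, hq, hrq, h1, h2⟩ := h.variation
    refine ⟨r, q, hr, hq, hrq, lt_of_le_of_lt (iSup_mono fun D => le_of_eq ?_) h1, h2⟩
    refine Finset.sum_congr rfl fun i hi => ?_
    have hi := Finset.mem_range.1 hi
    simp only [incr]
    rw [hf _ (D.first_le hi.le) (D.le_last hi.le),
      hf _ (D.first_le (i := i + 1) hi) (D.le_last (i := i + 1) hi)]
  limit := by
    intro ε hε
    obtain ⟨δ, hδ, hlim⟩ := h.limit ε hε
    refine ⟨δ, hδ, fun D ξ hD hξ => ?_⟩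
    have : ∑ i ∈ Finset.range D.n, f' (ξ i) (g (D.pt (i + 1)) - g (D.pt i))
        = ∑ i ∈ Finset.range D.n, f (ξ i) (g (D.pt (i + 1)) - g (D.pt i)) := by
      refine Finset.sum_congr rfl fun i hi => ?_
      have hi := Finset.mem_range.1 hi
      rw [hf _ ((D.first_le hi.le).trans (hξ i hi).1)
        ((hξ i hi).2.trans (D.le_last (i := i + 1) hi))]
    rw [this]
    exact hlim D ξ hD hξ

/-- Subtracting a constant from the integrand. -/
theorem HasYoungIntegral.sub_const {f : ℝ → G →L[ℝ] C} {g : ℝ → G} {s t : ℝ} {I : C}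
    (h : HasYoungIntegral f g s t I) (L : G →L[ℝ] C) :
    HasYoungIntegral (fun u => f u - L) g s t (I - L (g t - g s)) where
  continuousOn_left := h.continuousOn_left.sub continuousOn_const
  continuousOn_right := h.continuousOn_right
  variation := by
    obtain ⟨r, q, hr, hq, hrq, h1, h2⟩ := h.variation
    refine ⟨r, q, hr, hq, hrq, ?_, h2⟩
    have : incr (fun u => f u - L) = incr f := by
      funext s t; simp only [incr]; abel
    rwa [this]
  limit := by
    intro ε hε
    obtain ⟨δ, hδ, hlim⟩ := h.limit ε hε
    refine ⟨δ, hδ, fun D ξ hD hξ => ?_⟩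
    have htel : ∑ i ∈ Finset.range D.n, L (g (D.pt (i + 1)) - g (D.pt i)) = L (g t - g s) := by
      rw [← map_sum, Finset.sum_range_sub (fun i => g (D.pt i)), D.first, D.last]
    have : ∑ i ∈ Finset.range D.n, (f (ξ i) - L) (g (D.pt (i + 1)) - g (D.pt i)) -
          (I - L (g t - g s))
        = ∑ i ∈ Finset.range D.n, f (ξ i) (g (D.pt (i + 1)) - g (D.pt i)) - I := by
      simp only [sub_apply]
      rw [Finset.sum_sub_distrib, htel]; abel
    rw [this]
    exact hlim D ξ hD hξ

theorem IsRSLimit.sub {f f' : ℝ → G →L[ℝ] C} {g : ℝ → G} {s t : ℝ} {I I' : C}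
    (h : IsRSLimit f g s t I) (h' : IsRSLimit f' g s t I') :
    IsRSLimit (fun u => f u - f' u) g s t (I - I') := by
  intro ε hε
  obtain ⟨δ, hδ, h1⟩ := h (ε / 2) (half_pos hε)
  obtain ⟨δ', hδ', h2⟩ := h' (ε / 2) (half_pos hε)
  refine ⟨min δ δ', lt_min hδ hδ', fun D ξ hD hξ => ?_⟩
  have e1 := h1 D ξ (fun i hi => (hD i hi).trans_le (min_le_left _ _)) hξ
  have e2 := h2 D ξ (fun i hi => (hD i hi).trans_le (min_le_right _ _)) hξ
  simp only [sub_apply]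
  rw [Finset.sum_sub_distrib, sub_sub_sub_comm]
  exact (norm_sub_le _ _).trans_lt (by linarith)

theorem IsRSLimit.clm_comp {C' : Type*} [NormedAddCommGroup C'] [NormedSpace ℝ C']
    {f : ℝ → G →L[ℝ] C} {g : ℝ → G} {s t : ℝ} {I : C} (h : IsRSLimit f g s t I)
    (L : C →L[ℝ] C') : IsRSLimit (fun u => L.comp (f u)) g s t (L I) := by
  intro ε hε
  obtain ⟨δ, hδ, h1⟩ := h (ε / (‖L‖ + 1)) (by positivity)
  refine ⟨δ, hδ, fun D ξ hD hξ => ?_⟩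
  have e1 := h1 D ξ hD hξ
  simp only [ContinuousLinearMap.comp_apply]
  rw [← map_sum, ← map_sub]
  refine (L.le_opNorm _).trans_lt ?_
  rw [lt_div_iff₀ (by positivity)] at e1
  nlinarith [norm_nonneg (∑ i ∈ Finset.range D.n, f (ξ i) (g (D.pt (i + 1)) - g (D.pt i)) - I)]

theorem hasYoungIntegral_of_isRSLimit (hH : IsClock T H) (ha : 0 < a) (hb : 0 < b) (ha1 : a ≤ 1)
    (hb1 : b ≤ 1) (hab : 1 < a + b) {f : ℝ → G →L[ℝ] C} {g : ℝ → G} (hf : BigO T H a (incr f))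
    (hg : BigO T H b (incr g)) {s t : ℝ} (hs : 0 ≤ s) (ht : t ≤ T) {I : C}
    (h : IsRSLimit f g s t I) : HasYoungIntegral f g s t I where
  continuousOn_left := (hf.continuousOn hH ha).mono (Set.Icc_subset_Icc hs ht)
  continuousOn_right := (hg.continuousOn hH hb).mono (Set.Icc_subset_Icc hs ht)
  variation := by
    refine ⟨1 / a, 1 / b, ?_, ?_, ?_, hf.hasFinitePVar hH ha hs ht, hg.hasFinitePVar hH hb hs ht⟩
    · rwa [le_div_iff₀ ha, one_mul]
    · rwa [le_div_iff₀ hb, one_mul]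
    · rwa [one_div_one_div, one_div_one_div]
  limit := h

/-- **Young integration.** If the increments of `f` and `g` have orders `a` and `b` with
`a + b > 1`, then `∫ f dg` exists on every subinterval, is additive, and is approximated by
`f s (g t - g s)` to order `a + b`. -/
theorem exists_young [FiniteDimensional ℝ C] (hT : 0 ≤ T) (hH : IsClock T H) (ha : 0 < a)
    (hb : 0 < b) (ha1 : a ≤ 1) (hb1 : b ≤ 1) (hab : 1 < a + b) {f : ℝ → G →L[ℝ] C} {g : ℝ → G}
    (hf : BigO T H a (incr f)) (hg : BigO T H b (incr g)) :
    ∃ I : ℝ → C, BigO T H (a + b) (fun s t => I t - I s - f s (g t - g s)) ∧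
      ∀ s t, 0 ≤ s → s ≤ t → t ≤ T → HasYoungIntegral f g s t (I t - I s) := by
  obtain ⟨A, hA, hfA⟩ := id hf
  obtain ⟨B, hB, hgB⟩ := id hg
  -- change of the tag of an integrand
  have htag : ∀ s u v t, 0 ≤ s → s ≤ u → u ≤ t → s ≤ v → v ≤ t → t ≤ T →
      ‖(f u - f s) (g t - g v)‖ ≤ A * B * (H t - H s) ^ (a + b) := by
    intro s u v t hs hsu hut hsv hvt ht
    have h0 := hH.nonneg hs (hsu.trans hut) ht
    have h1 : ‖f u - f s‖ ≤ A * (H t - H s) ^ a := (hfA s u hs hsu (hut.trans ht)).trans <| by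
      have := hH.nonneg hs hsu (hut.trans ht)
      have := hH.le (hs.trans hsu) hut ht
      gcongr
    have h2 : ‖g t - g v‖ ≤ B * (H t - H s) ^ b := (hgB v t (hs.trans hsv) hvt ht).trans <| by
      have := hH.nonneg (hs.trans hsv) hvt ht
      have := hH.le hs hsv (hvt.trans ht)
      gcongr
    calc ‖(f u - f s) (g t - g v)‖ ≤ ‖f u - f s‖ * ‖g t - g v‖ := ContinuousLinearMap.le_opNorm _ _
      _ ≤ (A * (H t - H s) ^ a) * (B * (H t - H s) ^ b) :=
          mul_le_mul h1 h2 (norm_nonneg _) ((norm_nonneg _).trans h1)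
      _ = _ := by rw [Real.rpow_add_of_nonneg h0 ha.le hb.le]; ring
  obtain ⟨I, hI⟩ := exists_sewing hT hH hab (mul_nonneg hA hB) (Ξ := fun s t => f s (g t - g s))
    (fun s u t hs hsu hut ht => by
      have : f s (g t - g s) - f s (g u - g s) - f u (g t - g u) = -((f u - f s) (g t - g u)) := by
        simp only [sub_apply, map_sub]; abel
      rw [this, norm_neg]
      exact htag s u u t hs hsu hut hsu hut ht)
  refine ⟨I, hI, fun s t hs hst ht =>
    hasYoungIntegral_of_isRSLimit hH ha hb ha1 hb1 hab hf hg hs ht ?_⟩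
  intro ε hε
  obtain ⟨K, hK, hIK⟩ := hI
  have hM : 0 < A * B + K + 1 := by positivity
  obtain ⟨δ, hδ, hm⟩ := (hH.isControl zero_le_one).exists_mesh hab hs hst ht
    (show 0 < ε / (A * B + K + 1) by positivity)
  refine ⟨δ, hδ, fun D ξ hD hξ => ?_⟩
  have hsmall := hm D.n D.pt D.first D.last (fun i hi => (D.lt i hi).le) hD
  have htel : I t - I s = ∑ i ∈ Finset.range D.n, (I (D.pt (i + 1)) - I (D.pt i)) := by
    rw [Finset.sum_range_sub (fun i => I (D.pt i)), D.first, D.last]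
  rw [htel, ← Finset.sum_sub_distrib]
  have hterm : ∀ i ∈ Finset.range D.n,
      ‖f (ξ i) (g (D.pt (i + 1)) - g (D.pt i)) - (I (D.pt (i + 1)) - I (D.pt i))‖
        ≤ (A * B + K) * (1 * (H (D.pt (i + 1)) - H (D.pt i))) ^ (a + b) := by
    intro i hi
    have hi := Finset.mem_range.1 hi
    have h0 := hs.trans (D.first_le hi.le)
    have h1 := (D.le_last (i := i + 1) hi).trans ht
    have hle := (D.lt i hi).le
    have e1 := htag _ (ξ i) (D.pt i) _ h0 (hξ i hi).1 (hξ i hi).2 le_rfl hle h1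
    have e2 := hIK _ _ h0 hle h1
    have : f (ξ i) (g (D.pt (i + 1)) - g (D.pt i)) - (I (D.pt (i + 1)) - I (D.pt i))
        = (f (ξ i) - f (D.pt i)) (g (D.pt (i + 1)) - g (D.pt i))
          - (I (D.pt (i + 1)) - I (D.pt i) - f (D.pt i) (g (D.pt (i + 1)) - g (D.pt i))) := by
      simp only [sub_apply]; abel
    rw [this, one_mul, add_mul]
    exact (norm_sub_le _ _).trans (add_le_add e1 e2)
  refine (norm_sum_le_of_le _ hterm).trans_lt ?_
  rw [← Finset.mul_sum]
  calc _ ≤ (A * B + K) * (ε / (A * B + K + 1)) := by gcongr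
    _ < ε := by rw [mul_div_assoc', div_lt_iff₀ hM]; nlinarith

end Young

/-! ### The clock of a function of finite variation -/

section Variation

variable {E : Type*} [NormedAddCommGroup E] {r : ℝ} {Z : ℝ → ℝ → E}

/-- The concatenation of two partitions. -/
def IntervalPartition.concat {a u b : ℝ} (D : IntervalPartition a u) (D' : IntervalPartition u b) :
    IntervalPartition a b where
  n := D.n + D'.n
  pt i := if i ≤ D.n then D.pt i else D'.pt (i - D.n)
  first := by simp [D.first]
  last := by
    split_ifs with h
    · have h0 : D'.n = 0 := by omega
      have := D'.last
      rw [h0, D'.first] at this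
      rw [h0, add_zero, D.last, this]
    · rw [Nat.add_sub_cancel_left, D'.last]
  lt i hi := by
    rcases lt_trichotomy i D.n with h | h | h
    · rw [if_pos h.le, if_pos (Nat.succ_le_of_lt h)]; exact D.lt i h
    · subst h
      rw [if_pos le_rfl, if_neg (by omega), D.last, Nat.add_sub_cancel_left]
      exact D'.first.symm.trans_lt (D'.lt 0 (by omega))
    · rw [if_neg (by omega), if_neg (by omega), Nat.sub_add_comm h.le]
      exact D'.lt _ (by omega)

/-- The part of a partition between two of its points. -/
def IntervalPartition.between {a b c d : ℝ} (D : IntervalPartition a b) (j m : ℕ)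
    (h : j + m ≤ D.n) (hc : D.pt j = c) (hd : D.pt (j + m) = d) : IntervalPartition c d where
  n := m
  pt i := D.pt (j + i)
  first := hc
  last := hd
  lt i hi := D.lt (j + i) (by omega)

theorem pVar_add_le {a u b : ℝ} (hau : a ≤ u) (hub : u ≤ b) :
    pVar r a u Z + pVar r u b Z ≤ pVar r a b Z := by
  have : Nonempty (IntervalPartition a u) := ⟨(exists_partition hau one_pos).choose⟩
  have : Nonempty (IntervalPartition u b) := ⟨(exists_partition hub one_pos).choose⟩
  refine ENNReal.iSup_add_iSup_le fun D D' => ?_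
  refine le_trans (le_of_eq ?_) (le_iSup (fun D : IntervalPartition a b =>
    ∑ i ∈ Finset.range D.n, ‖Z (D.pt i) (D.pt (i + 1))‖ₑ ^ r) (D.concat D'))
  change _ = ∑ i ∈ Finset.range (D.n + D'.n), _
  rw [Finset.sum_range_add]
  congr 1
  · refine Finset.sum_congr rfl fun i hi => ?_
    have hi := Finset.mem_range.1 hi
    simp only [IntervalPartition.concat]
    rw [if_pos hi.le, if_pos (Nat.succ_le_of_lt hi)]
  · refine Finset.sum_congr rfl fun i _ => ?_
    simp only [IntervalPartition.concat]
    rw [if_neg (show ¬ D.n + i + 1 ≤ D.n by omega), add_assoc, Nat.add_sub_cancel_left]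
    rcases Nat.eq_zero_or_pos i with rfl | hi
    · simp [D.last, D'.first]
    · rw [if_neg (by omega), Nat.add_sub_cancel_left]

theorem pVar_mono {a b a' b' : ℝ} (h1 : a' ≤ a) (h2 : a ≤ b) (h3 : b ≤ b') :
    pVar r a b Z ≤ pVar r a' b' Z :=
  calc pVar r a b Z ≤ pVar r a b' Z := le_self_add.trans (pVar_add_le h2 h3)
    _ ≤ pVar r a' b' Z := le_add_self.trans (pVar_add_le h1 (h2.trans h3))

theorem enorm_rpow_le_pVar {a b : ℝ} (hab : a < b) : ‖Z a b‖ₑ ^ r ≤ pVar r a b Z := by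
  let D : IntervalPartition a b := ⟨1, fun i => if i = 0 then a else b, by simp, by simp,
    fun i hi => by simp [Nat.lt_one_iff.1 hi, hab]⟩
  refine le_trans (le_of_eq ?_) (le_iSup (fun D : IntervalPartition a b =>
    ∑ i ∈ Finset.range D.n, ‖Z (D.pt i) (D.pt (i + 1))‖ₑ ^ r) D)
  simp [D]

/-- A near-optimal partition of `[a, b]`, seen from a point `u`: the interval of the partition
around `u` is isolated, and the rest is bounded by the variation. -/
theorem exists_lt_pVar_split {a u b : ℝ} (hab : a < b) (hau : a ≤ u) (hub : u ≤ b) {c : ℝ≥0∞}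
    (hc : c < pVar r a b Z) : ∃ t₁ t₂, a ≤ t₁ ∧ t₁ ≤ u ∧ u ≤ t₂ ∧ t₂ ≤ b ∧ t₁ < t₂ ∧
      c < pVar r a t₁ Z + ‖Z t₁ t₂‖ₑ ^ r + pVar r t₂ b Z := by
  obtain ⟨D, hD⟩ := lt_iSup_iff.1 hc
  have hn : 0 < D.n := by
    rcases Nat.eq_zero_or_pos D.n with h | h
    · have := D.last
      rw [h, D.first] at this
      exact absurd this hab.ne
    · exact h
  set i := Nat.findGreatest (fun i => D.pt i ≤ u) (D.n - 1) with hi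
  have hin : i < D.n := by
    have := Nat.findGreatest_le (P := fun i => D.pt i ≤ u) (D.n - 1)
    omega
  have hiu : D.pt i ≤ u :=
    Nat.findGreatest_spec (P := fun i => D.pt i ≤ u) (Nat.zero_le _) (by rw [D.first]; exact hau)
  have hui : u ≤ D.pt (i + 1) := by
    rcases Nat.lt_or_ge (i + 1) D.n with h | h
    · exact le_of_not_ge (Nat.findGreatest_is_greatest (P := fun i => D.pt i ≤ u)
        (Nat.lt_succ_self i) (show i + 1 ≤ D.n - 1 by omega))
    · rw [show i + 1 = D.n by omega, D.last]; exact hub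
  obtain ⟨m, hm⟩ : ∃ m, D.n = i + 1 + m := ⟨D.n - (i + 1), by omega⟩
  refine ⟨D.pt i, D.pt (i + 1), D.first_le hin.le, hiu, hui, D.le_last hin, D.lt i hin,
    hD.trans_le ?_⟩
  have h1 : ∑ k ∈ Finset.range i, ‖Z (D.pt k) (D.pt (k + 1))‖ₑ ^ r ≤ pVar r a (D.pt i) Z := by
    have := le_iSup (fun D : IntervalPartition a (D.pt i) =>
      ∑ i ∈ Finset.range D.n, ‖Z (D.pt i) (D.pt (i + 1))‖ₑ ^ r)
      (D.between 0 i (by omega) D.first (by rw [zero_add]))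
    simpa only [IntervalPartition.between, zero_add, pVar] using this
  have h2 : ∑ k ∈ Finset.range m, ‖Z (D.pt (i + 1 + k)) (D.pt (i + 1 + k + 1))‖ₑ ^ r
      ≤ pVar r (D.pt (i + 1)) b Z :=
    le_iSup (fun D : IntervalPartition (D.pt (i + 1)) b =>
      ∑ i ∈ Finset.range D.n, ‖Z (D.pt i) (D.pt (i + 1))‖ₑ ^ r)
      (D.between (i + 1) m (by omega) rfl (by rw [← hm, D.last]))
  rw [hm, Finset.sum_range_add, Finset.sum_range_succ]
  gcongr

end Variation

/-- The abstract form of the continuity of the variation function: `w` is continuous and vanishes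
on the diagonal, and `V` is the smallest superadditive majorant of `w`, in the form `split`. -/
theorem isClock_of_split {T : ℝ} {V w : ℝ → ℝ → ℝ} (hV0 : ∀ a b, 0 ≤ V a b)
    (hadd : ∀ a u b, 0 ≤ a → a ≤ u → u ≤ b → b ≤ T → V a u + V u b ≤ V a b)
    (hwV : ∀ a b, 0 ≤ a → a ≤ b → b ≤ T → w a b ≤ V a b)
    (split : ∀ a u b c, 0 ≤ a → a < b → a ≤ u → u ≤ b → b ≤ T → c < V a b → ∃ t₁ t₂,
      a ≤ t₁ ∧ t₁ ≤ u ∧ u ≤ t₂ ∧ t₂ ≤ b ∧ t₁ < t₂ ∧ c < V a t₁ + w t₁ t₂ + V t₂ b)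
    (hw : ContinuousOn (fun z : ℝ × ℝ => w z.1 z.2) (simplex T)) :
    IsClock T (V 0) := by
  have hdiag : ∀ t, 0 ≤ t → t ≤ T → V t t = 0 := fun t h0 h1 => by
    have := hadd t t t h0 le_rfl le_rfl h1
    linarith [hV0 t t]
  have hmono : ∀ a u b, 0 ≤ a → a ≤ u → u ≤ b → b ≤ T → V a u ≤ V a b := fun a u b h0 h1 h2 h3 => by
    have := hadd a u b h0 h1 h2 h3
    linarith [hV0 u b]
  have hmono' : ∀ a u b, 0 ≤ a → a ≤ u → u ≤ b → b ≤ T → V u b ≤ V a b := by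
    intro a u b h0 h1 h2 h3
    have := hadd a u b h0 h1 h2 h3
    linarith [hV0 a u]
  -- otherwise mass at least `ε / 2` could be found arbitrarily often in disjoint intervals
  -- accumulating at `t`
  have hright : ∀ t, 0 ≤ t → t < T → ∀ ε > 0, ∃ b, t < b ∧ b ≤ T ∧ V t b < ε := by
    intro t ht0 htT ε hε
    by_contra! hge
    have key : ∀ n : ℕ, ∀ b, t < b → b ≤ T → n * (ε / 2) ≤ V t b := by
      intro n
      induction n with
      | zero => intro b _ _; simpa using hV0 t b
      | succ n ih =>
        intro b htb hbT
        obtain ⟨t₁, t₂, h1, h2, h3, h4, h5, h6⟩ := split t t b (ε / 2) ht0 htb le_rfl htb.le hbT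
          ((half_lt_self hε).trans_le (hge b htb hbT))
        obtain rfl : t = t₁ := le_antisymm h1 h2
        rw [hdiag t ht0 htT.le, zero_add] at h6
        obtain ⟨δ, hδ, hmod⟩ := exists_delta_of_continuousOn_simplex hw (sub_pos.2 h6)
        obtain ⟨τ, hτ1, hτ2⟩ := exists_between (lt_min (lt_add_of_pos_right t hδ) h5)
        have hτδ : τ < t + δ := hτ2.trans_le (min_le_left _ _)
        have hτt : τ < t₂ := hτ2.trans_le (min_le_right _ _)
        have hτ0 := ht0.trans hτ1.le
        have hm := hmod t t₂ τ t₂ ht0 h5.le (h4.trans hbT) hτ0 hτt.le (h4.trans hbT)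
          (by rw [abs_sub_comm, abs_of_pos (sub_pos.2 hτ1)]; linarith) (by simpa using hδ)
        have e1 := ih τ hτ1 (hτt.le.trans (h4.trans hbT))
        have e2 := hadd t τ b ht0 hτ1.le (hτt.le.trans h4) hbT
        have e3 := hadd τ t₂ b hτ0 hτt.le h4 hbT
        have e4 := hwV τ t₂ hτ0 hτt.le (h4.trans hbT)
        have e5 := (abs_lt.1 hm).2
        push_cast
        linarith
    obtain ⟨n, hn⟩ := exists_nat_gt (V t T / (ε / 2))
    rw [div_lt_iff₀ (half_pos hε)] at hn
    exact absurd (key n T htT le_rfl) (not_le.2 hn)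
  refine ⟨fun s hs t ht hst => hmono 0 s t le_rfl hs.1 hst ht.2, ?_⟩
  intro t ht
  rw [ContinuousWithinAt, Metric.tendsto_nhdsWithin_nhds]
  intro ε hε
  have hR : ∃ δ > 0, ∀ t', t < t' → t' < t + δ → t' ≤ T → V 0 t' < V 0 t + ε := by
    rcases ht.2.eq_or_lt with h | htT
    · exact ⟨1, one_pos, fun t' h1 _ h3 => absurd (h1.trans_le h3) (by simp [h])⟩
    obtain ⟨b, htb, hbT, hVb⟩ := hright t ht.1 htT (ε / 4) (by positivity)
    obtain ⟨δ, hδ, hmod⟩ := exists_delta_of_continuousOn_simplex hw (show 0 < ε / 4 by positivity)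
    refine ⟨min (b - t) δ, lt_min (sub_pos.2 htb) hδ, fun t' h1 h2 h3 => ?_⟩
    have hb' : t' < b := by have := min_le_left (b - t) δ; linarith
    have hδ' : t' < t + δ := by have := min_le_right (b - t) δ; linarith
    have : V 0 t' ≤ V 0 t + ε / 2 := by
      refine le_of_forall_lt fun c hc => ?_
      obtain ⟨t₁, t₂, g1, g2, g3, g4, g5, g6⟩ :=
        split 0 t t' c le_rfl (ht.1.trans_lt h1) ht.1 h1.le h3 hc
      have e1 := hmod t₁ t₂ t₁ t g1 g5.le (g4.trans h3) g1 g2 ht.2 (by simpa using hδ)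
        (by rw [abs_of_nonneg (sub_nonneg.2 g3)]; linarith)
      have e2 := hmono' t t₂ t' ht.1 g3 g4 h3
      have e3 := hmono t t' b ht.1 h1.le hb'.le hbT
      have e4 := hadd 0 t₁ t le_rfl g1 g2 ht.2
      have e5 := hwV t₁ t g1 g2 ht.2
      have e6 := (abs_lt.1 e1).2
      linarith
    linarith
  have hL : ∃ δ > 0, ∀ t', t' ≤ t → t - δ < t' → 0 ≤ t' → V 0 t - ε < V 0 t' := by
    rcases ht.1.eq_or_lt with h | ht0
    · exact ⟨1, one_pos, fun t' h1 _ h3 => by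
        rw [le_antisymm h1 (h ▸ h3)]; linarith⟩
    obtain ⟨t₁, t₂, g1, g2, g3, g4, g5, g6⟩ :=
      split 0 t t (V 0 t - ε) le_rfl ht0 ht.1 le_rfl ht.2 (by linarith)
    obtain rfl : t₂ = t := le_antisymm g4 g3
    rw [hdiag _ ht.1 ht.2, add_zero] at g6
    obtain ⟨δ, hδ, hmod⟩ := exists_delta_of_continuousOn_simplex hw (sub_pos.2 g6)
    refine ⟨min (t₂ - t₁) δ, lt_min (sub_pos.2 g5) hδ, fun t' h1 h2 h3 => ?_⟩
    have ht1 : t₁ < t' := by have := min_le_left (t₂ - t₁) δ; linarith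
    have e1 := hmod t₁ t₂ t₁ t' g1 g5.le ht.2 g1 ht1.le (h1.trans ht.2) (by simpa using hδ)
      (by rw [abs_of_nonneg (sub_nonneg.2 h1)]; have := min_le_right (t₂ - t₁) δ; linarith)
    have e2 := hwV t₁ t' g1 ht1.le (h1.trans ht.2)
    have e3 := hadd 0 t₁ t' le_rfl g1 ht1.le (h1.trans ht.2)
    have e4 := (abs_lt.1 e1).2
    linarith
  obtain ⟨δ, hδ, hR⟩ := hR
  obtain ⟨δ', hδ', hL⟩ := hL
  refine ⟨min δ δ', lt_min hδ hδ', fun {t'} ht' hd => ?_⟩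
  rw [Real.dist_eq] at hd ⊢
  have hd1 := hd.trans_le (min_le_left _ _)
  have hd2 := hd.trans_le (min_le_right _ _)
  rcases le_or_gt t' t with h | h
  · have e1 := hmono 0 t' t le_rfl ht'.1 h ht.2
    have e2 := hL t' h (by have := (abs_lt.1 hd2).1; linarith) ht'.1
    rw [abs_lt]; constructor <;> linarith
  · have e1 := hmono 0 t t' le_rfl ht.1 h.le ht'.2
    have e2 := hR t' h (by have := (abs_lt.1 hd1).2; linarith) ht'.2
    rw [abs_lt]; constructor <;> linarith

section Variation

variable {E : Type*} [NormedAddCommGroup E] {r T : ℝ} {Z : ℝ → ℝ → E}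

/-- A continuous function of finite `r`-variation that vanishes on the diagonal is of order `1 / r`
with respect to some clock, namely the `r`-variation on `[0, t]` as a function of `t`. -/
theorem exists_clock (hr : 0 < r)
    (hc : ContinuousOn (fun z : ℝ × ℝ => Z z.1 z.2) (simplex T))
    (hdiag : ∀ t, 0 ≤ t → t ≤ T → Z t t = 0) (hfin : HasFinitePVar r 0 T Z) :
    ∃ H, IsClock T H ∧ BigO T H (1 / r) Z := by
  have hlt : ∀ {a b}, 0 ≤ a → a ≤ b → b ≤ T → pVar r a b Z ≠ ∞ := fun h0 h1 h2 =>
    ((pVar_mono h0 h1 h2).trans_lt hfin).ne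
  have hadd : ∀ a u b, 0 ≤ a → a ≤ u → u ≤ b → b ≤ T →
      (pVar r a u Z).toReal + (pVar r u b Z).toReal ≤ (pVar r a b Z).toReal := by
    intro a u b h0 h1 h2 h3
    rw [← ENNReal.toReal_add (hlt h0 h1 (h2.trans h3)) (hlt (h0.trans h1) h2 h3)]
    exact ENNReal.toReal_mono (hlt h0 (h1.trans h2) h3) (pVar_add_le h1 h2)
  have hnorm : ∀ a b, (‖Z a b‖ₑ ^ r).toReal = ‖Z a b‖ ^ r := fun a b => by
    rw [← ENNReal.toReal_rpow, toReal_enorm]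
  have hwV : ∀ a b, 0 ≤ a → a ≤ b → b ≤ T → ‖Z a b‖ ^ r ≤ (pVar r a b Z).toReal := by
    intro a b h0 h1 h2
    rcases h1.eq_or_lt with rfl | h
    · rw [hdiag a h0 h2, norm_zero, Real.zero_rpow hr.ne']; exact ENNReal.toReal_nonneg
    · rw [← hnorm]
      exact ENNReal.toReal_mono (hlt h0 h1 h2) (enorm_rpow_le_pVar h)
  have hclock : IsClock T fun t => (pVar r 0 t Z).toReal := by
    refine isClock_of_split (V := fun a b => (pVar r a b Z).toReal) (w := fun a b => ‖Z a b‖ ^ r)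
      (fun _ _ => ENNReal.toReal_nonneg) hadd hwV ?_ (hc.norm.rpow_const fun _ _ => Or.inr hr.le)
    intro a u b c h0 hab hau hub hbT hcV
    rcases lt_or_ge c 0 with hc0 | hc0
    · rcases hub.eq_or_lt with rfl | hlt'
      · exact ⟨a, u, le_rfl, hau, le_rfl, le_rfl, hab, hc0.trans_le (by positivity)⟩
      · exact ⟨a, b, le_rfl, hau, hub, le_rfl, hab, hc0.trans_le (by positivity)⟩
    obtain ⟨t₁, t₂, g1, g2, g3, g4, g5, g6⟩ := exists_lt_pVar_split (r := r) (Z := Z) hab hau hub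
      ((ENNReal.ofReal_lt_iff_lt_toReal hc0 (hlt h0 hab.le hbT)).2 hcV)
    refine ⟨t₁, t₂, g1, g2, g3, g4, g5, ?_⟩
    have n1 := hlt h0 g1 (g5.le.trans (g4.trans hbT))
    have n2 := hlt (h0.trans (g1.trans g5.le)) g4 hbT
    have n3 : ‖Z t₁ t₂‖ₑ ^ r ≠ ∞ := ENNReal.rpow_ne_top_of_nonneg hr.le enorm_ne_top
    rw [ENNReal.ofReal_lt_iff_lt_toReal hc0
        (ENNReal.add_ne_top.2 ⟨ENNReal.add_ne_top.2 ⟨n1, n3⟩, n2⟩),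
      ENNReal.toReal_add (ENNReal.add_ne_top.2 ⟨n1, n3⟩) n2, ENNReal.toReal_add n1 n3, hnorm] at g6
    exact g6
  refine ⟨_, hclock, BigO.of_norm_le hclock 1 fun s t hs hst ht => ?_⟩
  rw [one_mul]
  calc ‖Z s t‖ = (‖Z s t‖ ^ r) ^ (1 / r) := by
        rw [← Real.rpow_mul (norm_nonneg _), mul_one_div_cancel hr.ne', Real.rpow_one]
    _ ≤ _ := by
        have e1 := hwV s t hs hst ht
        have e2 := hadd 0 s t le_rfl hs hst ht
        exact Real.rpow_le_rpow (by positivity) (by linarith) (by positivity)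

theorem IsClock.add {H₁ H₂ : ℝ → ℝ} (h₁ : IsClock T H₁) (h₂ : IsClock T H₂) :
    IsClock T (fun t => H₁ t + H₂ t) :=
  ⟨h₁.mono.add h₂.mono, h₁.cont.add h₂.cont⟩

theorem isClock_id (T : ℝ) : IsClock T (fun t => t) :=
  ⟨monotoneOn_id, continuousOn_id⟩

theorem BigO.mono_clock {H H' : ℝ → ℝ} {a : ℝ} (ha : 0 ≤ a) (hH : IsClock T H)
    (hle : ∀ s t, 0 ≤ s → s ≤ t → t ≤ T → H t - H s ≤ H' t - H' s) (hZ : BigO T H a Z) :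
    BigO T H' a Z := by
  obtain ⟨C, hC, hZ⟩ := hZ
  refine ⟨C, hC, fun s t hs hst ht => (hZ s t hs hst ht).trans ?_⟩
  have := hH.nonneg hs hst ht
  have := hle s t hs hst ht
  gcongr

theorem BigO.add_clock_right {H H' : ℝ → ℝ} {a : ℝ} (ha : 0 ≤ a) (hH : IsClock T H)
    (hH' : IsClock T H') (hZ : BigO T H a Z) : BigO T (fun t => H t + H' t) a Z :=
  hZ.mono_clock ha hH fun s t hs hst ht => by linarith [hH'.nonneg hs hst ht]

theorem BigO.add_clock_left {H H' : ℝ → ℝ} {a : ℝ} (ha : 0 ≤ a) (hH : IsClock T H)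
    (hH' : IsClock T H') (hZ : BigO T H' a Z) : BigO T (fun t => H t + H' t) a Z :=
  hZ.mono_clock ha hH' fun s t hs hst ht => by linarith [hH.nonneg hs hst ht]

end Variation

/-! ### Rough paths with respect to a clock -/

section RoughPath

variable {V : Type*} [NormedAddCommGroup V] [InnerProductSpace ℝ V] {p T : ℝ} {H : ℝ → ℝ}

/-- Chen's identity together with the bounds `X¹ = O(ω ^ (1 / p))`, `X² = O(ω ^ (2 / p))`, where
`ω` is the control given by the clock `H`. -/
structure RoughBounds (p T : ℝ) (H : ℝ → ℝ) (X : TwoLevel V) : Prop where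
  chen_lvl1 : ∀ s u t, 0 ≤ s → s ≤ u → u ≤ t → t ≤ T → X.lvl1 s t = X.lvl1 s u + X.lvl1 u t
  chen_lvl2 : ∀ s u t, 0 ≤ s → s ≤ u → u ≤ t → t ≤ T →
    X.lvl2 s t = X.lvl2 s u + X.lvl1 s u ⊗ₜ[ℝ] X.lvl1 u t + X.lvl2 u t
  bigO_lvl1 : BigO T H (1 / p) X.lvl1
  bigO_lvl2 : BigO T H (2 / p) X.lvl2

/-- A function of nonnegative order, restricted to intervals starting at `0`, is bounded. -/
theorem BigO.bounded_from_zero {E : Type*} [NormedAddCommGroup E] (hH : IsClock T H) {a : ℝ}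
    (ha : 0 ≤ a) {R : ℝ → ℝ → E} (hR : BigO T H a R) : BigO T H 0 (fun s _ => R 0 s) := by
  obtain ⟨C, -, h⟩ := hR.weaken hH le_rfl ha
  refine BigO.of_bounded C fun s t hs hst ht => ?_
  have := h 0 s le_rfl hs (hst.trans ht)
  rwa [Real.rpow_zero, mul_one] at this

theorem RoughBounds.lvl1_eq {X : TwoLevel V} (hX : RoughBounds p T H X) {s t : ℝ} (hs : 0 ≤ s)
    (hst : s ≤ t) (ht : t ≤ T) : X.lvl1 s t = X.path t - X.path s := by
  rw [TwoLevel.path, TwoLevel.path, hX.chen_lvl1 0 s t le_rfl hs hst ht, add_sub_cancel_left]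

theorem RoughBounds.bigO_path {X : TwoLevel V} (hX : RoughBounds p T H X) :
    BigO T H (1 / p) (incr X.path) :=
  hX.bigO_lvl1.congr fun _ _ hs hst ht => (hX.lvl1_eq hs hst ht).symm

theorem RoughBounds.isRoughPath {X : TwoLevel V} (hX : RoughBounds p T H X) (hp : 0 < p)
    (hH : IsClock T H) : IsRoughPath p T X := by
  have hp1 : 0 < 1 / p := by positivity
  have hp2 : 0 < 2 / p := by positivity
  have hfst : Set.MapsTo (fun z : ℝ × ℝ => z.1) (simplex T) (Set.Icc 0 T) := fun z hz =>
    ⟨hz.1, hz.2.1.trans hz.2.2⟩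
  have hsnd : Set.MapsTo (fun z : ℝ × ℝ => z.2) (simplex T) (Set.Icc 0 T) := fun z hz =>
    ⟨hz.1.trans hz.2.1, hz.2.2⟩
  have c1 : ContinuousOn X.path (Set.Icc 0 T) := hX.bigO_path.continuousOn hH hp1
  have c2 : ContinuousOn (X.lvl2 0) (Set.Icc 0 T) := by
    have e1 : BigO T H (1 / p) X.lvl2 := hX.bigO_lvl2.weaken hH hp1.le (by gcongr; norm_num)
    have e2 : BigO T H (0 + 1 / p) (fun s t => X.lvl1 0 s ⊗ₜ[ℝ] X.lvl1 s t) :=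
      BigO.mul_of_norm_le hH le_rfl hp1.le 1 (hX.bigO_lvl1.bounded_from_zero hH hp1.le)
        hX.bigO_lvl1 fun s t _ _ _ => by rw [TensorProduct.norm_tmul, one_mul]
    rw [zero_add] at e2
    refine BigO.continuousOn hH hp1 ((e1.add e2).congr fun s t hs hst ht => ?_)
    rw [incr, hX.chen_lvl2 0 s t le_rfl hs hst ht]; abel
  have c1' : ContinuousOn (fun z : ℝ × ℝ => X.lvl1 z.1 z.2) (simplex T) :=
    ((c1.comp continuousOn_snd hsnd).sub (c1.comp continuousOn_fst hfst)).congr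
      fun z hz => hX.lvl1_eq hz.1 hz.2.1 hz.2.2
  refine ⟨c1', ?_, hX.chen_lvl1, hX.chen_lvl2, ?_, ?_⟩
  · have c3 : ContinuousOn (fun z : ℝ × ℝ => X.path z.1 ⊗ₜ[ℝ] X.lvl1 z.1 z.2) (simplex T) :=
      (TensorProduct.continuous_tmul (𝕜 := ℝ) (E := V) (F := V)).comp_continuousOn
        ((c1.comp continuousOn_fst hfst).prodMk c1')
    refine (((c2.comp continuousOn_snd hsnd).sub (c2.comp continuousOn_fst hfst)).sub c3).congr
      fun z hz => ?_
    change _ = X.lvl2 0 z.2 - X.lvl2 0 z.1 - X.lvl1 0 z.1 ⊗ₜ[ℝ] X.lvl1 z.1 z.2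
    rw [hX.chen_lvl2 0 z.1 z.2 le_rfl hz.1 hz.2.1 hz.2.2]; abel
  · simpa using hX.bigO_lvl1.hasFinitePVar hH hp1 le_rfl le_rfl
  · simpa using hX.bigO_lvl2.hasFinitePVar hH hp2 le_rfl le_rfl

theorem IsRoughPath.lvl1_self {X : TwoLevel V} (hX : IsRoughPath p T X) {t : ℝ} (h0 : 0 ≤ t)
    (h1 : t ≤ T) : X.lvl1 t t = 0 := by
  simpa using hX.chen_lvl1 t t t h0 le_rfl le_rfl h1

theorem IsRoughPath.lvl2_self {X : TwoLevel V} (hX : IsRoughPath p T X) {t : ℝ} (h0 : 0 ≤ t)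
    (h1 : t ≤ T) : X.lvl2 t t = 0 := by
  have := hX.chen_lvl2 t t t h0 le_rfl le_rfl h1
  rw [hX.lvl1_self h0 h1, TensorProduct.zero_tmul, add_zero] at this
  simpa using this

theorem IsRoughPath.exists_roughBounds {X : TwoLevel V} (hX : IsRoughPath p T X) (hp : 0 < p) :
    ∃ H, IsClock T H ∧ RoughBounds p T H X := by
  obtain ⟨H₁, hH₁, h₁⟩ := exists_clock hp hX.continuousOn_lvl1
    (fun t h0 h1 => hX.lvl1_self h0 h1) hX.finite_lvl1
  obtain ⟨H₂, hH₂, h₂⟩ := exists_clock (half_pos hp) hX.continuousOn_lvl2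
    (fun t h0 h1 => hX.lvl2_self h0 h1) hX.finite_lvl2
  rw [one_div_div] at h₂
  exact ⟨_, hH₁.add hH₂, hX.chen_lvl1, hX.chen_lvl2,
    h₁.add_clock_right (by positivity) hH₁ hH₂, h₂.add_clock_left (by positivity) hH₁ hH₂⟩

theorem RoughBounds.add_clock_right {H' : ℝ → ℝ} {X : TwoLevel V} (hX : RoughBounds p T H X)
    (hp : 0 < p) (hH : IsClock T H) (hH' : IsClock T H') :
    RoughBounds p T (fun t => H t + H' t) X :=
  ⟨hX.chen_lvl1, hX.chen_lvl2, hX.bigO_lvl1.add_clock_right (by positivity) hH hH',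
    hX.bigO_lvl2.add_clock_right (by positivity) hH hH'⟩

theorem RoughBounds.perturb {X : TwoLevel V} (hX : RoughBounds p T H X) {φ : ℝ → V ⊗[ℝ] V}
    (hφ : BigO T H (2 / p) (incr φ)) : RoughBounds p T H (perturb X φ) where
  chen_lvl1 := hX.chen_lvl1
  chen_lvl2 s u t hs hsu hut ht := by
    simp only [RoughIto.perturb]
    rw [hX.chen_lvl2 s u t hs hsu hut ht]; abel
  bigO_lvl1 := hX.bigO_lvl1
  bigO_lvl2 := hX.bigO_lvl2.sub hφ

end RoughPath

/-! ### Existence and uniqueness criteria for rough integrals -/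

section RoughIntegral

variable {V W : Type*} [NormedAddCommGroup V] [InnerProductSpace ℝ V] [FiniteDimensional ℝ V]
  [NormedAddCommGroup W] [InnerProductSpace ℝ W] {p T : ℝ} {H : ℝ → ℝ}
  {f : V → V →L[ℝ] W} {X : TwoLevel V}

theorem RoughBounds.isRoughIntegral {Y : TwoLevel W} (hY : RoughBounds p T H Y) (hp : 0 < p)
    (hH : IsClock T H) {θ : ℝ} (hθ : 1 < θ)
    (h1 : BigO T H θ (fun s t => Y.lvl1 s t - (almostIntegral f X).lvl1 s t))
    (h2 : BigO T H θ (fun s t => Y.lvl2 s t - (almostIntegral f X).lvl2 s t)) :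
    IsRoughIntegral p T f X Y := by
  obtain ⟨K₁, hK₁, h1⟩ := h1.exists_le hH (by linarith)
  obtain ⟨K₂, _, h2⟩ := h2.exists_le hH (by linarith)
  refine ⟨hY.isRoughPath hp hH, fun s t => max K₁ K₂ * (H t - H s), θ,
    hH.isControl (le_max_of_le_left hK₁), hθ, fun s t hs hst ht => ⟨?_, ?_⟩⟩
  · exact h1 _ (le_max_left _ _) s t hs hst ht
  · exact h2 _ (le_max_right _ _) s t hs hst ht

theorem IsRoughIntegral.unique {Y Y' : TwoLevel W} (hY : IsRoughIntegral p T f X Y)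
    (hY' : IsRoughIntegral p T f X Y') {s t : ℝ} (hs : 0 ≤ s) (hst : s ≤ t) (ht : t ≤ T) :
    Y.lvl1 s t = Y'.lvl1 s t ∧ Y.lvl2 s t = Y'.lvl2 s t := by
  obtain ⟨hr, ω, θ, hω, hθ, h⟩ := hY
  obtain ⟨hr', ω', θ', hω', hθ', h'⟩ := hY'
  have key1 : ∀ s t, 0 ≤ s → s ≤ t → t ≤ T → Y.lvl1 s t = Y'.lvl1 s t := by
    intro s t hs hst ht
    rw [← sub_eq_zero]
    refine eq_zero_of_additive hω hω' hθ hθ' (D := fun s t => Y.lvl1 s t - Y'.lvl1 s t)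
      (fun s u t hs hsu hut ht => ?_) (fun s t hs hst ht => ?_) hs hst ht
    · rw [hr.chen_lvl1 s u t hs hsu hut ht, hr'.chen_lvl1 s u t hs hsu hut ht]; abel
    · have e : Y.lvl1 s t - Y'.lvl1 s t = (Y.lvl1 s t - (almostIntegral f X).lvl1 s t)
          - (Y'.lvl1 s t - (almostIntegral f X).lvl1 s t) := by abel
      simp only [e]
      exact (norm_sub_le _ _).trans (add_le_add (h s t hs hst ht).1 (h' s t hs hst ht).1)
  refine ⟨key1 s t hs hst ht, ?_⟩
  rw [← sub_eq_zero]
  refine eq_zero_of_additive hω hω' hθ hθ' (D := fun s t => Y.lvl2 s t - Y'.lvl2 s t)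
    (fun s u t hs hsu hut ht => ?_) (fun s t hs hst ht => ?_) hs hst ht
  · rw [hr.chen_lvl2 s u t hs hsu hut ht, hr'.chen_lvl2 s u t hs hsu hut ht,
      key1 s u hs hsu (hut.trans ht), key1 u t (hs.trans hsu) hut ht]; abel
  · have e : Y.lvl2 s t - Y'.lvl2 s t = (Y.lvl2 s t - (almostIntegral f X).lvl2 s t)
        - (Y'.lvl2 s t - (almostIntegral f X).lvl2 s t) := by abel
    simp only [e]
    exact (norm_sub_le _ _).trans (add_le_add (h s t hs hst ht).2 (h' s t hs hst ht).2)

end RoughIntegral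

/-! ### Geometric rough paths -/

section Geometric

variable {V W : Type*} [NormedAddCommGroup V] [InnerProductSpace ℝ V] [FiniteDimensional ℝ V]
  [NormedAddCommGroup W] [InnerProductSpace ℝ W] {p T : ℝ}

/-- The symmetric part of the second level is the one of a smooth path:
`X² + (X²)ᵀ = X¹ ⊗ X¹`. -/
def HasShuffle (T : ℝ) (X : TwoLevel V) : Prop :=
  ∀ s t, 0 ≤ s → s ≤ t → t ≤ T → X.lvl2 s t + TensorProduct.comm ℝ V V (X.lvl2 s t)
    = X.lvl1 s t ⊗ₜ[ℝ] X.lvl1 s t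

/-- The Riemann sums with left tags and the transposed ones with right tags add up to a telescoping
sum. -/
theorem IsCanonicalLift.hasShuffle {x : ℝ → V} {L : TwoLevel V} (hL : IsCanonicalLift T x L) :
    HasShuffle T L := by
  intro s t hs hst ht
  have hlim := (hL.lvl2_eq s t hs hst ht).limit
  rw [hL.lvl1_eq s t hs hst ht, ← sub_eq_zero, ← norm_le_zero_iff]
  refine le_of_forall_pos_le_add fun ε hε => ?_
  obtain ⟨δ, hδ, h⟩ := hlim (ε / 2) (half_pos hε)
  obtain ⟨D, hD⟩ := exists_partition hst hδ
  have h1 := h D D.pt hD fun i hi => ⟨le_rfl, (D.lt i hi).le⟩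
  have h2 := h D (fun i => D.pt (i + 1)) hD fun i hi => ⟨(D.lt i hi).le, le_rfl⟩
  simp only [tmulL_apply] at h1 h2
  set y : ℕ → V := fun i => x (D.pt i) - x s with hy
  have hdiff : ∀ i, x (D.pt (i + 1)) - x (D.pt i) = y (i + 1) - y i := fun i => by
    simp only [hy]; abel
  simp only [hdiff] at h1 h2
  set S₁ := ∑ i ∈ Finset.range D.n, y i ⊗ₜ[ℝ] (y (i + 1) - y i) with hS₁
  set S₂ := ∑ i ∈ Finset.range D.n, y (i + 1) ⊗ₜ[ℝ] (y (i + 1) - y i) with hS₂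
  have htel : S₁ + TensorProduct.comm ℝ V V S₂ = (x t - x s) ⊗ₜ[ℝ] (x t - x s) := by
    have e : ∀ a b : V, a ⊗ₜ[ℝ] (b - a) + (b - a) ⊗ₜ[ℝ] b = b ⊗ₜ[ℝ] b - a ⊗ₜ[ℝ] a := fun a b => by
      rw [TensorProduct.tmul_sub, TensorProduct.sub_tmul]; abel
    rw [hS₁, hS₂, map_sum, ← Finset.sum_add_distrib]
    simp only [TensorProduct.comm_tmul, e]
    rw [Finset.sum_range_sub (fun i => y i ⊗ₜ[ℝ] y i)]
    simp [hy, D.first, D.last]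
  rw [← htel, zero_add]
  calc _ = ‖-((S₁ - L.lvl2 s t) + TensorProduct.comm ℝ V V (S₂ - L.lvl2 s t))‖ := by
        rw [map_sub]; congr 1; abel
    _ ≤ ‖S₁ - L.lvl2 s t‖ + ‖S₂ - L.lvl2 s t‖ := by
        rw [norm_neg]
        exact (norm_add_le _ _).trans (by rw [TensorProduct.norm_comm])
    _ ≤ ε := by linarith

theorem enorm_le_pVar_rpow {E : Type*} [NormedAddCommGroup E] {r : ℝ} (hr : 0 < r)
    {Z : ℝ → ℝ → E} {s t : ℝ} (hs : 0 ≤ s) (hst : s < t) (ht : t ≤ T) :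
    ‖Z s t‖ₑ ≤ pVar r 0 T Z ^ (1 / r) :=
  calc ‖Z s t‖ₑ = (‖Z s t‖ₑ ^ r) ^ (1 / r) := by
        rw [← ENNReal.rpow_mul, mul_one_div_cancel hr.ne', ENNReal.rpow_one]
    _ ≤ _ := ENNReal.rpow_le_rpow ((enorm_rpow_le_pVar hst).trans (pVar_mono hs hst.le ht))
        (by positivity)

theorem IsGeometricRoughPath.hasShuffle {X : TwoLevel V} (hX : IsGeometricRoughPath p T X)
    (hp : 0 < p) : HasShuffle T X := by
  obtain ⟨hr, x, L, hL, hlim⟩ := hX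
  intro s t hs hst ht
  rcases hst.eq_or_lt with rfl | hlt
  · rw [hr.lvl2_self hs ht, hr.lvl1_self hs ht]; simp
  have l1 : Filter.Tendsto (fun n => (L n).lvl1 s t) Filter.atTop (nhds (X.lvl1 s t)) := by
    rw [tendsto_iff_edist_tendsto_0]
    refine tendsto_of_tendsto_of_tendsto_of_le_of_le tendsto_const_nhds hlim
      (fun _ => zero_le) fun n => ?_
    rw [edist_eq_enorm_sub]
    exact (enorm_le_pVar_rpow (Z := fun s t => (L n).lvl1 s t - X.lvl1 s t) hp hs hlt ht).trans
      le_self_add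
  have l2 : Filter.Tendsto (fun n => (L n).lvl2 s t) Filter.atTop (nhds (X.lvl2 s t)) := by
    rw [tendsto_iff_edist_tendsto_0]
    refine tendsto_of_tendsto_of_tendsto_of_le_of_le tendsto_const_nhds hlim
      (fun _ => zero_le) fun n => ?_
    rw [edist_eq_enorm_sub]
    have := enorm_le_pVar_rpow (Z := fun s t => (L n).lvl2 s t - X.lvl2 s t) (half_pos hp) hs hlt ht
    rw [one_div_div] at this
    exact this.trans le_add_self
  have l3 := l2.add (((TensorProduct.commIsometry ℝ V V).continuous.tendsto _).comp l2)
  have l4 := ((TensorProduct.continuous_tmul (𝕜 := ℝ) (E := V) (F := V)).tendsto _).comp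
    (l1.prodMk_nhds l1)
  refine tendsto_nhds_unique l3 (l4.congr fun n => ?_)
  exact ((hL n).hasShuffle s t hs hst ht).symm

/-- A symmetric bilinear map sees only the symmetric part of the second level. -/
theorem HasShuffle.contract_eq {X : TwoLevel V} (hX : HasShuffle T X) {B : V →L[ℝ] V →L[ℝ] W}
    (hB : ∀ v w, B v w = B w v) {s t : ℝ} (hs : 0 ≤ s) (hst : s ≤ t) (ht : t ≤ T) :
    contract B (X.lvl2 s t) = (1 / 2 : ℝ) • B (X.lvl1 s t) (X.lvl1 s t) := by
  have hcomm : ∀ z : V ⊗[ℝ] V, contract B (TensorProduct.comm ℝ V V z) = contract B z := by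
    intro z
    induction z with
    | zero => simp
    | tmul v w => simp [hB v w]
    | add x y hx hy => simp [hx, hy]
  have := congrArg (contract B) (hX s t hs hst ht)
  rw [map_add, hcomm, contract_tmul, ← two_smul ℝ] at this
  rw [← this, smul_smul]; norm_num

end Geometric

/-! ### The space-time rough path -/

section SpaceTime

variable {V : Type*} [NormedAddCommGroup V] [InnerProductSpace ℝ V]
  {p T : ℝ} {H : ℝ → ℝ} {X : TwoLevel V}

theorem pt_eq (x : V) (r : ℝ) : pt x r = inSpace V x + r • timeVec V := by
  rw [inSpace_apply, timeVec, pt, pt, pt, ← WithLp.toLp_smul, ← WithLp.toLp_add]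
  simp

theorem spaceTime_path (X : TwoLevel V) (t : ℝ) : (spaceTime X).path t = pt (X.path t) t := by
  simp [TwoLevel.path, spaceTime]

/-- The cross integrals `A s t = ∫_s^t X¹_{s,u} du` and `B s t = ∫_s^t (u - s) dX_u` of a rough
path with time, with their orders, their behaviour under concatenation and integration by parts. -/
theorem RoughBounds.exists_cross [FiniteDimensional ℝ V] (hX : RoughBounds p T H X) (hp : 1 ≤ p)
    (hT : 0 ≤ T) (hH : IsClock T H) (htime : BigO T H 1 (incr fun t => t)) :
    ∃ A B : ℝ → ℝ → V,
      (∀ s t, 0 ≤ s → s ≤ t → t ≤ T →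
        HasYoungIntegral (crossLeft X s) (fun u => u) s t (A s t) ∧
        HasYoungIntegral (crossRight V s) X.path s t (B s t) ∧
        A s t + B s t = (t - s) • X.lvl1 s t) ∧
      (∀ s u t, 0 ≤ s → s ≤ u → u ≤ t → t ≤ T →
        A s t = A s u + A u t + (t - u) • X.lvl1 s u ∧
        B s t = B s u + B u t + (u - s) • X.lvl1 u t) ∧
      BigO T H (1 / p + 1) A ∧ BigO T H (1 / p + 1) B := by
  have hp0 : 0 < p := by linarith
  have hp1 : 0 < 1 / p := by positivity
  have hp1' : 1 / p ≤ 1 := by rw [div_le_one hp0]; exact hp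
  set f : ℝ → ℝ →L[ℝ] V := fun u => ContinuousLinearMap.toSpanSingleton ℝ (X.path u) with hf
  set g : ℝ → V →L[ℝ] V := fun u => u • ContinuousLinearMap.id ℝ V with hg
  have hfO : BigO T H (1 / p) (incr f) := by
    refine BigO.of_norm_le_mul_norm hH hp1.le 1 hX.bigO_path fun s t _ _ _ => ?_
    have : incr f s t = ContinuousLinearMap.toSpanSingleton ℝ (incr X.path s t) := by
      ext; simp [incr, hf]
    rw [this, one_mul, ContinuousLinearMap.norm_toSpanSingleton]
  have hgO : BigO T H 1 (incr g) := by
    refine BigO.of_norm_le_mul_norm hH zero_le_one ‖ContinuousLinearMap.id ℝ V‖ htime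
      fun s t _ _ _ => ?_
    rw [incr, hg, ← sub_smul, norm_smul, mul_comm, incr]
  obtain ⟨I, hI, hIY⟩ := exists_young hT hH hp1 one_pos hp1' le_rfl (by linarith) hfO htime
  obtain ⟨J, hJ, hJY⟩ := exists_young hT hH one_pos hp1 le_rfl hp1' (by linarith) hgO hX.bigO_path
  rw [add_comm] at hJ
  have hIe : ∀ s t, I t - I s - f s (t - s) = I t - I s - (t - s) • X.path s := fun s t => by
    simp [hf]
  have hJe : ∀ s t, J t - J s - g s (X.path t - X.path s)
      = J t - J s - s • (X.path t - X.path s) := fun s t => by simp [hg]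
  have hparts : ∀ s t, 0 ≤ s → s ≤ t → t ≤ T →
      (I t - I s) + (J t - J s) - (t • X.path t - s • X.path s) = 0 := by
    intro s t hs hst ht
    have hOt : BigO T H (1 / p + 1) (fun s t => (t - s) • X.lvl1 s t) :=
      BigO.mul_of_norm_le hH hp1.le zero_le_one 1 hX.bigO_lvl1 htime fun s t _ _ _ => by
        rw [norm_smul, one_mul, mul_comm, incr]
    have hD : BigO T H (1 / p + 1)
        (fun s t => (I t - I s) + (J t - J s) - (t • X.path t - s • X.path s)) := by
      refine ((hI.add hJ).sub hOt).congr fun s t hs hst ht => ?_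
      rw [hIe, hJe, hX.lvl1_eq hs hst ht]
      module
    obtain ⟨K, hK, hD⟩ := hD.exists_le hH (by linarith)
    refine eq_zero_of_additive (hH.isControl hK) (hH.isControl hK)
      (show 1 < 1 / p + 1 by linarith) (show 1 < 1 / p + 1 by linarith)
      (D := fun s t => (I t - I s) + (J t - J s) - (t • X.path t - s • X.path s))
      (fun s u t _ _ _ _ => by abel) (fun s t hs hst ht => ?_) hs hst ht
    exact (hD K le_rfl s t hs hst ht).trans (le_add_of_nonneg_right
      (Real.rpow_nonneg (mul_nonneg hK (hH.nonneg hs hst ht)) _))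
  refine ⟨fun s t => I t - I s - (t - s) • X.path s,
    fun s t => J t - J s - s • (X.path t - X.path s),
    fun s t hs hst ht => ⟨?_, ?_, ?_⟩, fun s u t hs hsu hut ht => ⟨?_, ?_⟩,
    hI.congr fun s t _ _ _ => (hIe s t).symm, hJ.congr fun s t _ _ _ => (hJe s t).symm⟩
  · have := ((hIY s t hs hst ht).sub_const (f s)).congr (f' := crossLeft X s) fun u hsu hut => by
      ext; simp [hf, crossLeft, hX.lvl1_eq hs hsu (hut.trans ht)]
    simpa [hf] using this
  · have := ((hJY s t hs hst ht).sub_const (g s)).congr (f' := crossRight V s) fun u _ _ => by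
      rw [crossRight, hg, sub_smul]
    simpa [hg] using this
  · have := sub_eq_zero.1 (hparts s t hs hst ht)
    rw [hX.lvl1_eq hs hst ht]
    have e : I t - I s - (t - s) • X.path s + (J t - J s - s • (X.path t - X.path s))
        = (I t - I s) + (J t - J s) - ((t - s) • X.path s + s • (X.path t - X.path s)) := by abel
    rw [e, this]; module
  · rw [hX.lvl1_eq hs hsu (hut.trans ht)]; module
  · rw [hX.lvl1_eq (hs.trans hsu) hut ht]; module

theorem RoughBounds.youngIntegrable_cross [FiniteDimensional ℝ V] (hX : RoughBounds p T H X)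
    (hp : 1 ≤ p) (hT : 0 ≤ T) (hH : IsClock T H) (htime : BigO T H 1 (incr fun t => t))
    {s t : ℝ} (hs : 0 ≤ s) (hst : s ≤ t) (ht : t ≤ T) :
    YoungIntegrable (crossLeft X s) (fun u => u) s t ∧
      YoungIntegrable (crossRight V s) X.path s t := by
  obtain ⟨A, B, h, -⟩ := hX.exists_cross hp hT hH htime
  exact ⟨⟨_, (h s t hs hst ht).1⟩, ⟨_, (h s t hs hst ht).2.1⟩⟩

theorem spaceTime_lvl2_eq {A B : ℝ → ℝ → V} {s t : ℝ} (hst : s ≤ t)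
    (hA : HasYoungIntegral (crossLeft X s) (fun u => u) s t (A s t))
    (hB : HasYoungIntegral (crossRight V s) X.path s t (B s t)) :
    (spaceTime X).lvl2 s t = TensorProduct.mapL (inSpace V) (inSpace V) (X.lvl2 s t)
      + inSpace V (A s t) ⊗ₜ[ℝ] timeVec V + timeVec V ⊗ₜ[ℝ] inSpace V (B s t)
      + ((t - s) ^ 2 / 2) • (timeVec V ⊗ₜ[ℝ] timeVec V) := by
  simp only [spaceTime]
  rw [hA.youngIntegral_eq hst, hB.youngIntegral_eq hst]

theorem RoughBounds.spaceTime [FiniteDimensional ℝ V] (hX : RoughBounds p T H X) (hp : 2 ≤ p)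
    (hT : 0 ≤ T) (hH : IsClock T H) (htime : BigO T H 1 (incr fun t => t)) :
    RoughBounds p T H (spaceTime X) := by
  have hp0 : 0 < p := by linarith
  have hp1 : 1 / p ≤ 1 := by rw [div_le_one hp0]; linarith
  have hp2 : 2 / p ≤ 1 := by rw [div_le_one hp0]; linarith
  have hp2' : 0 ≤ 2 / p := by positivity
  obtain ⟨A, B, hAB, hchen, hA, hB⟩ := hX.exists_cross (by linarith) hT hH htime
  refine ⟨fun s u t hs hsu hut ht => ?_, fun s u t hs hsu hut ht => ?_, ?_, ?_⟩
  · simp only [RoughIto.spaceTime, pt_eq]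
    rw [hX.chen_lvl1 s u t hs hsu hut ht, map_add]
    module
  · obtain ⟨a1, a2, -⟩ := hAB s t hs (hsu.trans hut) ht
    obtain ⟨b1, b2, -⟩ := hAB s u hs hsu (hut.trans ht)
    obtain ⟨c1, c2, -⟩ := hAB u t (hs.trans hsu) hut ht
    obtain ⟨hA', hB'⟩ := hchen s u t hs hsu hut ht
    rw [spaceTime_lvl2_eq (hsu.trans hut) a1 a2, spaceTime_lvl2_eq hsu b1 b2,
      spaceTime_lvl2_eq hut c1 c2, hA', hB', hX.chen_lvl2 s u t hs hsu hut ht]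
    simp only [RoughIto.spaceTime, pt_eq, map_add, map_smul, TensorProduct.mapL_tmul,
      TensorProduct.add_tmul, TensorProduct.tmul_add, TensorProduct.tmul_smul,
      ← TensorProduct.smul_tmul']
    module
  · have e1 : BigO T H (1 / p) (fun s t => inSpace V (X.lvl1 s t)) :=
      hX.bigO_lvl1.of_norm_le_mul_norm hH (by positivity) ‖inSpace V‖
        fun s t _ _ _ => ContinuousLinearMap.le_opNorm _ _
    have e2 : BigO T H (1 / p) (fun s t : ℝ => (t - s) • timeVec V) :=
      (htime.weaken hH (by positivity) hp1).of_norm_le_mul_norm hH (by positivity) ‖timeVec V‖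
        fun s t _ _ _ => by rw [norm_smul, mul_comm, incr]
    exact (e1.add e2).congr fun s t _ _ _ => by simp only [RoughIto.spaceTime, pt_eq]
  · have e1 : BigO T H (2 / p)
        (fun s t => TensorProduct.mapL (inSpace V) (inSpace V) (X.lvl2 s t)) :=
      hX.bigO_lvl2.of_norm_le_mul_norm hH hp2' ‖TensorProduct.mapL (inSpace V) (inSpace V)‖
        fun s t _ _ _ => ContinuousLinearMap.le_opNorm _ _
    have hexp : 2 / p ≤ 1 / p + 1 := by
      have : 2 / p = 1 / p + 1 / p := by ring
      linarith
    have e2 : BigO T H (2 / p) (fun s t => inSpace V (A s t) ⊗ₜ[ℝ] timeVec V) :=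
      (hA.weaken hH hp2' hexp).of_norm_le_mul_norm hH hp2' (‖inSpace V‖ * ‖timeVec V‖)
        fun s t _ _ _ => by
          rw [TensorProduct.norm_tmul, mul_right_comm]
          gcongr
          exact ContinuousLinearMap.le_opNorm _ _
    have e3 : BigO T H (2 / p) (fun s t => timeVec V ⊗ₜ[ℝ] inSpace V (B s t)) :=
      (hB.weaken hH hp2' hexp).of_norm_le_mul_norm hH hp2' (‖timeVec V‖ * ‖inSpace V‖)
        fun s t _ _ _ => by
          rw [TensorProduct.norm_tmul, mul_assoc]
          gcongr
          exact ContinuousLinearMap.le_opNorm _ _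
    have e4 : BigO T H (2 / p)
        (fun s t : ℝ => ((t - s) ^ 2 / 2) • (timeVec V ⊗ₜ[ℝ] timeVec V)) := by
      have := BigO.mul_of_norm_le hH zero_le_one zero_le_one
        (1 / 2 * ‖timeVec V ⊗ₜ[ℝ] timeVec V‖) htime htime
        (R := fun s t : ℝ => ((t - s) ^ 2 / 2) • (timeVec V ⊗ₜ[ℝ] timeVec V))
        fun s t _ _ _ => by
          rw [norm_smul, incr, norm_div, norm_pow, Real.norm_two]
          exact le_of_eq (by ring)
      exact this.weaken hH hp2' (by linarith)
    refine (((e1.add e2).add e3).add e4).congr fun s t hs hst ht => ?_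
    obtain ⟨a1, a2, -⟩ := hAB s t hs hst ht
    exact spaceTime_lvl2_eq hst a1 a2

theorem HasShuffle.spaceTime [FiniteDimensional ℝ V] (hS : HasShuffle T X)
    (hX : RoughBounds p T H X) (hp : 1 ≤ p) (hT : 0 ≤ T) (hH : IsClock T H)
    (htime : BigO T H 1 (incr fun t => t)) :
    HasShuffle T (spaceTime X) := by
  obtain ⟨A, B, hAB, -⟩ := hX.exists_cross hp hT hH htime
  intro s t hs hst ht
  obtain ⟨a1, a2, a3⟩ := hAB s t hs hst ht
  have hcomm : ∀ z : V ⊗[ℝ] V, TensorProduct.comm ℝ _ _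
      (TensorProduct.mapL (inSpace V) (inSpace V) z)
        = TensorProduct.mapL (inSpace V) (inSpace V) (TensorProduct.comm ℝ V V z) := by
    intro z
    induction z with
    | zero => simp
    | tmul v w => simp
    | add x y hx hy => simp only [map_add, hx, hy]
  have hB : B s t = (t - s) • X.lvl1 s t - A s t := by rw [← a3]; abel
  have h2 : X.lvl1 s t ⊗ₜ[ℝ] X.lvl1 s t - X.lvl2 s t = TensorProduct.comm ℝ V V (X.lvl2 s t) := by
    rw [← hS s t hs hst ht]; abel
  rw [spaceTime_lvl2_eq hst a1 a2, hB]
  simp only [map_add, map_smul, map_sub, hcomm, ← h2, TensorProduct.mapL_tmul,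
    TensorProduct.comm_tmul, RoughIto.spaceTime, pt_eq, TensorProduct.add_tmul,
    TensorProduct.tmul_add, TensorProduct.tmul_sub, TensorProduct.tmul_smul,
    ← TensorProduct.smul_tmul']
  module

theorem spaceTime_perturb_lvl1 (X : TwoLevel V) (φ : ℝ → V ⊗[ℝ] V) :
    (spaceTime (perturb X φ)).lvl1 = (spaceTime X).lvl1 := rfl

theorem spaceTime_perturb_lvl2 (X : TwoLevel V) (φ : ℝ → V ⊗[ℝ] V) (s t : ℝ) :
    (spaceTime (perturb X φ)).lvl2 s t
      = (spaceTime X).lvl2 s t - TensorProduct.mapL (inSpace V) (inSpace V) (φ t - φ s) := by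
  have h1 : crossLeft (perturb X φ) = crossLeft X := rfl
  have h2 : (perturb X φ).path = X.path := rfl
  simp only [spaceTime, h1, h2]
  rw [perturb, map_sub]
  abel

end SpaceTime

/-! ### Functions with bounded Hölder second derivative -/

section Taylor

variable {E W : Type*} [NormedAddCommGroup E] [NormedSpace ℝ E] [NormedAddCommGroup W]
  [NormedSpace ℝ W]

/-- `F` is twice continuously differentiable, its first two derivatives are bounded by `M`, and the
second one is `α`-Hölder with constant `M`. -/
structure HasHolderHessian (α M : ℝ) (F : E → W) : Prop where
  contDiff : ContDiff ℝ 2 F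
  fderiv_le : ∀ x, ‖fderiv ℝ F x‖ ≤ M
  hessian_le : ∀ x, ‖fderiv ℝ (fderiv ℝ F) x‖ ≤ M
  holder : ∀ x y, ‖fderiv ℝ (fderiv ℝ F) x - fderiv ℝ (fderiv ℝ F) y‖ ≤ M * ‖x - y‖ ^ α

theorem norm_hessian_sub_le (F : E → W) (x y : E) :
    ‖fderiv ℝ (fderiv ℝ F) x - fderiv ℝ (fderiv ℝ F) y‖
      ≤ ‖iteratedFDeriv ℝ 2 F x - iteratedFDeriv ℝ 2 F y‖ := by
  refine ContinuousLinearMap.opNorm_le_bound₂ _ (norm_nonneg _) fun v w => ?_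
  have h := (iteratedFDeriv ℝ 2 F x - iteratedFDeriv ℝ 2 F y).le_opNorm ![v, w]
  rw [sub_apply, iteratedFDeriv_two_apply, iteratedFDeriv_two_apply,
    Fin.prod_univ_two, ← mul_assoc] at h
  simpa using h

/-- A `Lip(γ)` function with `γ > p ≥ 2` has bounded first and second derivatives, the second one
being `α`-Hölder for some `α ≤ 1` with `2 + α > p`. -/
theorem IsLip.exists_hasHolderHessian {F : E → W} {p γ : ℝ} (hF : IsLip γ F) (hp2 : 2 ≤ p)
    (hp3 : p < 3) (hγ : p < γ) :
    ∃ α M, 0 < α ∧ α ≤ 1 ∧ p < 2 + α ∧ HasHolderHessian α M F := by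
  obtain ⟨k, M, hk1, hk2, hC, hbd, hhol⟩ := hF
  have hk : 2 ≤ k := by
    have : (1 : ℝ) < k := by linarith
    exact_mod_cast this
  have hC2 : ContDiff ℝ 2 F := hC.of_le (by exact_mod_cast hk)
  have b1 : ∀ x, ‖fderiv ℝ F x‖ ≤ M := fun x => by
    rw [← norm_iteratedFDeriv_one]; exact hbd 1 (by omega) x
  have b2 : ∀ x, ‖fderiv ℝ (fderiv ℝ F) x‖ ≤ M := fun x => by
    rw [← norm_iteratedFDeriv_one, norm_iteratedFDeriv_fderiv]; exact hbd 2 hk x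
  rcases hk.eq_or_lt with rfl | hk3
  · push_cast at hk1 hk2
    refine ⟨γ - 2, M, by linarith, by linarith, by linarith, hC2, b1, b2, fun x y => ?_⟩
    exact (norm_hessian_sub_le F x y).trans (by exact_mod_cast hhol x y)
  · refine ⟨1, M, one_pos, le_rfl, by linarith, hC2, b1, b2, fun x y => ?_⟩
    have hC3 : ContDiff ℝ 3 F := hC.of_le (by exact_mod_cast hk3)
    have hd1 : ContDiff ℝ 2 (fderiv ℝ F) := hC3.fderiv_right (by norm_num)
    have hd2 : ContDiff ℝ 1 (fderiv ℝ (fderiv ℝ F)) := hd1.fderiv_right (by norm_num)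
    rw [Real.rpow_one]
    refine convex_univ.norm_image_sub_le_of_norm_fderiv_le (𝕜 := ℝ)
      (fun z _ => (hd2.differentiable (by norm_num)) z) (fun z _ => ?_) (Set.mem_univ y)
      (Set.mem_univ x)
    rw [← norm_iteratedFDeriv_one, norm_iteratedFDeriv_fderiv, norm_iteratedFDeriv_fderiv]
    exact hbd 3 hk3 z

namespace HasHolderHessian

variable {α M : ℝ} {F : E → W}

theorem nonneg (hF : HasHolderHessian α M F) : 0 ≤ M := (norm_nonneg _).trans (hF.fderiv_le 0)

theorem differentiable (hF : HasHolderHessian α M F) : Differentiable ℝ F :=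
  hF.contDiff.differentiable (by norm_num)

theorem differentiable_fderiv (hF : HasHolderHessian α M F) : Differentiable ℝ (fderiv ℝ F) :=
  (hF.contDiff.fderiv_right (m := 1) (by norm_num)).differentiable (by norm_num)

theorem symm (hF : HasHolderHessian α M F) (x v w : E) :
    fderiv ℝ (fderiv ℝ F) x v w = fderiv ℝ (fderiv ℝ F) x w v :=
  (hF.contDiff.contDiffAt.isSymmSndFDerivAt (by simp)).eq v w

theorem norm_image_sub_le (hF : HasHolderHessian α M F) (x y : E) : ‖F y - F x‖ ≤ M * ‖y - x‖ :=
  convex_univ.norm_image_sub_le_of_norm_fderiv_le (𝕜 := ℝ) (fun z _ => hF.differentiable z)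
    (fun z _ => hF.fderiv_le z) (Set.mem_univ x) (Set.mem_univ y)

theorem norm_fderiv_sub_le (hF : HasHolderHessian α M F) (x y : E) :
    ‖fderiv ℝ F y - fderiv ℝ F x‖ ≤ M * ‖y - x‖ :=
  convex_univ.norm_image_sub_le_of_norm_fderiv_le (𝕜 := ℝ) (fun z _ => hF.differentiable_fderiv z)
    (fun z _ => hF.hessian_le z) (Set.mem_univ x) (Set.mem_univ y)

theorem norm_sub_of_mem_segment {x y z : E} (hz : z ∈ segment ℝ x y) : ‖z - x‖ ≤ ‖y - x‖ := by
  simpa [dist_eq_norm] using (convex_closedBall x ‖y - x‖).segment_subset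
    (Metric.mem_closedBall_self (norm_nonneg _)) (by simp [dist_eq_norm]) hz

theorem taylor_one (hF : HasHolderHessian α M F) (x y : E) :
    ‖F y - F x - fderiv ℝ F x (y - x)‖ ≤ M * (‖y - x‖ * ‖y - x‖) := by
  rw [← mul_assoc]
  refine (convex_segment x y).norm_image_sub_le_of_norm_hasFDerivWithin_le'
    (fun z _ => (hF.differentiable z).hasFDerivAt.hasFDerivWithinAt) (fun z hz => ?_)
    (left_mem_segment ℝ x y) (right_mem_segment ℝ x y)
  exact (hF.norm_fderiv_sub_le x z).trans
    (mul_le_mul_of_nonneg_left (norm_sub_of_mem_segment hz) hF.nonneg)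

theorem taylor_fderiv (hF : HasHolderHessian α M F) (hα : 0 < α) (x y : E) :
    ‖fderiv ℝ F y - fderiv ℝ F x - fderiv ℝ (fderiv ℝ F) x (y - x)‖
      ≤ M * ‖y - x‖ ^ α * ‖y - x‖ := by
  refine (convex_segment x y).norm_image_sub_le_of_norm_hasFDerivWithin_le'
    (fun z _ => (hF.differentiable_fderiv z).hasFDerivAt.hasFDerivWithinAt) (fun z hz => ?_)
    (left_mem_segment ℝ x y) (right_mem_segment ℝ x y)
  exact (hF.holder z x).trans (mul_le_mul_of_nonneg_left
    (Real.rpow_le_rpow (norm_nonneg _) (norm_sub_of_mem_segment hz) hα.le) hF.nonneg)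

theorem taylor_two (hF : HasHolderHessian α M F) (hα : 0 < α) (x y : E) :
    ‖F y - F x - fderiv ℝ F x (y - x) - (1 / 2 : ℝ) • fderiv ℝ (fderiv ℝ F) x (y - x) (y - x)‖
      ≤ M * (‖y - x‖ ^ α * (‖y - x‖ * ‖y - x‖)) := by
  set B := fderiv ℝ (fderiv ℝ F) x with hB
  set g : E → W := fun z => F z - (1 / 2 : ℝ) • B (z - x) (z - x) with hg
  have hgd : ∀ z, HasFDerivAt g (fderiv ℝ F z - B (z - x)) z := by
    intro z
    have h1 : HasFDerivAt (fun z : E => z - x) (ContinuousLinearMap.id ℝ E) z :=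
      (hasFDerivAt_id z).sub_const x
    have h2 := B.hasFDerivAt_of_bilinear h1 h1
    refine ((hF.differentiable z).hasFDerivAt.sub (h2.const_smul (1 / 2 : ℝ))).congr_fderiv ?_
    ext v
    simp only [sub_apply, smul_apply, ContinuousLinearMap.precompR_apply,
      ContinuousLinearMap.precompL_apply, ContinuousLinearMap.id_apply, add_apply]
    rw [hB, hF.symm x v (z - x)]
    change _ - (1 / 2 : ℝ) • (fderiv ℝ (fderiv ℝ F) x (z - x) v
      + fderiv ℝ (fderiv ℝ F) x (z - x) v) = _
    module
  have key := (convex_segment x y).norm_image_sub_le_of_norm_hasFDerivWithin_le'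
    (f := g) (φ := fderiv ℝ F x) (C := M * ‖y - x‖ ^ α * ‖y - x‖)
    (fun z _ => (hgd z).hasFDerivWithinAt) (fun z hz => ?_)
    (left_mem_segment ℝ x y) (right_mem_segment ℝ x y)
  · have e : g y - g x - fderiv ℝ F x (y - x)
        = F y - F x - fderiv ℝ F x (y - x) - (1 / 2 : ℝ) • B (y - x) (y - x) := by
      simp only [hg, sub_self, map_zero, smul_zero, sub_zero]; abel
    rw [e] at key
    refine key.trans (le_of_eq (by ring))
  · have h1 := hF.taylor_fderiv hα x z
    have h2 := norm_sub_of_mem_segment hz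
    have hM := hF.nonneg
    have e : fderiv ℝ F z - B (z - x) - fderiv ℝ F x = fderiv ℝ F z - fderiv ℝ F x - B (z - x) := by
      abel
    rw [e]
    exact h1.trans (by gcongr)

end HasHolderHessian

end Taylor

/-! ### Space derivatives as linear images of the full derivatives -/

section SpaceDerivatives

variable {V W : Type*} [NormedAddCommGroup V] [InnerProductSpace ℝ V]
  [NormedAddCommGroup W] [InnerProductSpace ℝ W] {F : SpaceTime V → W} {α M : ℝ}

theorem hasFDerivAt_pt (x : V) (t : ℝ) : HasFDerivAt (fun y => pt y t) (inSpace V) x := by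
  simp only [pt_eq]
  exact (inSpace V).hasFDerivAt.add_const _

theorem HasHolderHessian.Dx_eq (hF : HasHolderHessian α M F) (x : V) (t : ℝ) :
    Dx F x t = (fderiv ℝ F (pt x t)).comp (inSpace V) :=
  ((hF.differentiable (pt x t)).hasFDerivAt.comp x (hasFDerivAt_pt x t)).fderiv

theorem HasHolderHessian.Dxx_eq [FiniteDimensional ℝ V] (hF : HasHolderHessian α M F) (x : V)
    (t : ℝ) : Dxx F x t = (contract (fderiv ℝ (fderiv ℝ F) (pt x t))).comp
      (TensorProduct.mapL (inSpace V) (inSpace V)) := by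
  have h1 : HasFDerivAt (fun y => Dx F y t)
      ((ContinuousLinearMap.compL ℝ V (SpaceTime V) W).flip (inSpace V) ∘L
        (fderiv ℝ (fderiv ℝ F) (pt x t)).comp (inSpace V)) x := by
    simp only [hF.Dx_eq]
    exact ((ContinuousLinearMap.compL ℝ V (SpaceTime V) W).flip (inSpace V)).hasFDerivAt.comp x
      ((hF.differentiable_fderiv (pt x t)).hasFDerivAt.comp x (hasFDerivAt_pt x t))
  rw [Dxx, h1.fderiv]
  ext z
  induction z with
  | zero => simp
  | tmul v w => simp
  | add x y hx hy => simp only [map_add, hx, hy]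

set_option maxSynthPendingDepth 3 in
theorem exists_norm_contract_sub_le (V W : Type*) [NormedAddCommGroup V] [InnerProductSpace ℝ V]
    [FiniteDimensional ℝ V] [NormedAddCommGroup W] [InnerProductSpace ℝ W]
    [FiniteDimensional ℝ W] : ∃ C, 0 ≤ C ∧ ∀ A B : V →L[ℝ] V →L[ℝ] W,
      ‖contract A - contract B‖ ≤ C * ‖A - B‖ := by
  let L : (V →L[ℝ] V →L[ℝ] W) →ₗ[ℝ] V ⊗[ℝ] V →L[ℝ] W :=
    { toFun := contract
      map_add' := fun A B => by
        ext z
        induction z with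
        | zero => simp
        | tmul v w => simp
        | add x y hx hy => simp only [map_add, hx, hy]
      map_smul' := fun c A => by
        ext z
        induction z with
        | zero => simp
        | tmul v w => simp
        | add x y hx hy => simp only [map_add, hx, hy] }
  refine ⟨‖LinearMap.toContinuousLinearMap L‖, norm_nonneg _, fun A B => ?_⟩
  exact (congrArg norm (map_sub L A B)).symm.trans_le
    ((LinearMap.toContinuousLinearMap L).le_opNorm (A - B))

end SpaceDerivatives

/-! ### The rough integral of a gradient -/

section Gradient

variable {T : ℝ} {H : ℝ → ℝ} {a b : ℝ}

theorem BigO.norm_rpow {E : Type*} [NormedAddCommGroup E] (hH : IsClock T H) {R : ℝ → ℝ → E}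
    (hR : BigO T H a R) {α : ℝ} (hα : 0 ≤ α) : BigO T H (α * a) (fun s t => ‖R s t‖ ^ α) := by
  obtain ⟨C, hC, hR⟩ := hR
  refine BigO.of_norm_le hH (C ^ α) fun s t hs hst ht => ?_
  have h0 := hH.nonneg hs hst ht
  rw [Real.norm_of_nonneg (by positivity), mul_comm α a, Real.rpow_mul h0,
    ← Real.mul_rpow hC (Real.rpow_nonneg h0 _)]
  exact Real.rpow_le_rpow (norm_nonneg _) (hR s t hs hst ht) hα

variable {E W : Type*} [NormedAddCommGroup E] [InnerProductSpace ℝ E]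
  [NormedAddCommGroup W] [InnerProductSpace ℝ W] {α M p : ℝ} {F : E → W} {X : TwoLevel E}

theorem norm_mapL_self_sub_le (A B : E →L[ℝ] W) :
    ‖TensorProduct.mapL A A - TensorProduct.mapL B B‖ ≤ (‖A‖ + ‖B‖) * ‖A - B‖ := by
  have h1 := TensorProduct.mapL_add_left (A - B) B A
  have h2 := TensorProduct.mapL_add_right B (A - B) B
  rw [sub_add_cancel] at h1 h2
  have e : TensorProduct.mapL A A - TensorProduct.mapL B B
      = TensorProduct.mapL (A - B) A + TensorProduct.mapL B (A - B) := by
    rw [h1, h2]; abel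
  rw [e]
  refine (norm_add_le (TensorProduct.mapL (A - B) A) (TensorProduct.mapL B (A - B))).trans ?_
  linarith [TensorProduct.norm_mapL_le (A - B) A, TensorProduct.norm_mapL_le B (A - B)]

variable [FiniteDimensional ℝ E]

/-- Chain rule to order `(2 + α) / p`: by the second-order Taylor formula, since the symmetric
Hessian sees only the symmetric part of the second level. -/
theorem HasHolderHessian.bigO_lvl1 (hF : HasHolderHessian α M F) (hα : 0 < α) (hp : 0 < p)
    (hH : IsClock T H) (hX : RoughBounds p T H X) (hS : HasShuffle T X) :
    BigO T H ((2 + α) / p) (fun s t => F (X.path t) - F (X.path s)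
      - (almostIntegral (fderiv ℝ F) X).lvl1 s t) := by
  have hp1 : 0 ≤ 1 / p := by positivity
  have h2 := BigO.mul_of_norm_le hH hp1 hp1 1 hX.bigO_lvl1 hX.bigO_lvl1
    (R := fun s t => ‖X.lvl1 s t‖ * ‖X.lvl1 s t‖) fun s t _ _ _ => by simp
  have h3 := BigO.mul_of_norm_le hH (by positivity) (by positivity) M
    (hX.bigO_lvl1.norm_rpow hH hα.le) h2
    (R := fun s t => F (X.path t) - F (X.path s) - (almostIntegral (fderiv ℝ F) X).lvl1 s t)
    fun s t hs hst ht => by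
      have e : F (X.path t) - F (X.path s) - (almostIntegral (fderiv ℝ F) X).lvl1 s t
          = F (X.path t) - F (X.path s) - fderiv ℝ F (X.path s) (X.path t - X.path s)
            - (1 / 2 : ℝ) • fderiv ℝ (fderiv ℝ F) (X.path s) (X.path t - X.path s)
                (X.path t - X.path s) := by
        simp only [almostIntegral]
        rw [hS.contract_eq (hF.symm (X.path s)) hs hst ht, hX.lvl1_eq hs hst ht]
        abel
      simp only [e]
      rw [hX.lvl1_eq hs hst ht, Real.norm_of_nonneg (by positivity),
        Real.norm_of_nonneg (by positivity)]
      exact hF.taylor_two hα _ _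
  have e : α * (1 / p) + (1 / p + 1 / p) = (2 + α) / p := by ring
  rwa [e] at h3

/-- The second level of the rough integral of `DF` is obtained by sewing
`F(X_s) ⊗ (F(X_t) - F(X_s)) + (DF(X_s) ⊗ DF(X_s)) X²_{s,t}`. -/
theorem HasHolderHessian.exists_lvl2 [FiniteDimensional ℝ W] (hF : HasHolderHessian α M F)
    (hp2 : 2 ≤ p) (hp3 : p < 3) (hT : 0 ≤ T) (hH : IsClock T H) (hX : RoughBounds p T H X) :
    ∃ J : ℝ → W ⊗[ℝ] W, BigO T H (3 / p) (fun s t => J t - J s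
      - F (X.path s) ⊗ₜ[ℝ] (F (X.path t) - F (X.path s))
      - (almostIntegral (fderiv ℝ F) X).lvl2 s t) := by
  have hp : 0 < p := by linarith
  have hM := hF.nonneg
  obtain ⟨C₁, hC₁, h1⟩ := hX.bigO_path
  obtain ⟨C₂, hC₂, h2⟩ := hX.bigO_lvl2
  set K := 3 * M ^ 2 * C₁ ^ 3 + 2 * M ^ 2 * C₁ * C₂ with hK
  have hθ : 1 < 3 / p := by rw [lt_div_iff₀ hp]; linarith
  suffices hδ : ∀ s u t, 0 ≤ s → s ≤ u → u ≤ t → t ≤ T →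
      ‖F (X.path s) ⊗ₜ[ℝ] (F (X.path t) - F (X.path s)) + (almostIntegral (fderiv ℝ F) X).lvl2 s t
        - (F (X.path s) ⊗ₜ[ℝ] (F (X.path u) - F (X.path s))
            + (almostIntegral (fderiv ℝ F) X).lvl2 s u)
        - (F (X.path u) ⊗ₜ[ℝ] (F (X.path t) - F (X.path u))
            + (almostIntegral (fderiv ℝ F) X).lvl2 u t)‖ ≤ K * (H t - H s) ^ (3 / p) by
    obtain ⟨J, hJ⟩ := exists_sewing hT hH hθ (by positivity) hδ
    exact ⟨J, hJ.congr fun s t _ _ _ => sub_sub _ _ _⟩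
  intro s u t hs hsu hut ht
  have hw := hH.nonneg hs (hsu.trans hut) ht
  set w := H t - H s with hwdef
  set P := C₁ * w ^ (1 / p) with hP
  set Q := C₂ * w ^ (2 / p) with hQ
  have hP0 : 0 ≤ P := mul_nonneg hC₁ (Real.rpow_nonneg hw _)
  have hxsu : ‖X.path u - X.path s‖ ≤ P := (h1 s u hs hsu (hut.trans ht)).trans <| by
    have := hH.nonneg hs hsu (hut.trans ht)
    have := hH.le (hs.trans hsu) hut ht
    rw [hP, hwdef]
    gcongr
  have hxut : ‖X.path t - X.path u‖ ≤ P := (h1 u t (hs.trans hsu) hut ht).trans <| by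
    have := hH.nonneg (hs.trans hsu) hut ht
    have := hH.le hs hsu (hut.trans ht)
    rw [hP, hwdef]
    gcongr
  have hXut : ‖X.lvl2 u t‖ ≤ Q := (h2 u t (hs.trans hsu) hut ht).trans <| by
    have := hH.nonneg (hs.trans hsu) hut ht
    have := hH.le hs hsu (hut.trans ht)
    rw [hQ, hwdef]
    gcongr
  have hKw : K * w ^ (3 / p) = M * (P * P) * (M * P) + M * P * (M * (P * P) + M * P * P)
      + (M + M) * (M * P) * Q := by
    have e2 : w ^ (2 / p) = w ^ (1 / p) * w ^ (1 / p) := by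
      rw [← Real.rpow_add_of_nonneg hw (by positivity) (by positivity)]; congr 1; ring
    have e3 : w ^ (3 / p) = w ^ (1 / p) * w ^ (1 / p) * w ^ (1 / p) := by
      rw [← e2, ← Real.rpow_add_of_nonneg hw (by positivity) (by positivity)]; congr 1; ring
    rw [hP, hQ, e2, e3, hK]; ring
  rw [hKw]
  set x := X.path s with hx
  set y := X.path u with hy
  set z := X.path t with hz
  set A := fderiv ℝ F x with hA
  set B := fderiv ℝ F y with hB
  have hXeq : X.lvl2 s t = X.lvl2 s u + (y - x) ⊗ₜ[ℝ] (z - y) + X.lvl2 u t := by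
    rw [hX.chen_lvl2 s u t hs hsu hut ht, hX.lvl1_eq hs hsu (hut.trans ht),
      hX.lvl1_eq (hs.trans hsu) hut ht]
  have hsplit : F x ⊗ₜ[ℝ] (F z - F x) + (almostIntegral (fderiv ℝ F) X).lvl2 s t
        - (F x ⊗ₜ[ℝ] (F y - F x) + (almostIntegral (fderiv ℝ F) X).lvl2 s u)
        - (F y ⊗ₜ[ℝ] (F z - F y) + (almostIntegral (fderiv ℝ F) X).lvl2 u t)
      = -((F y - F x - A (y - x)) ⊗ₜ[ℝ] (F z - F y))
        - A (y - x) ⊗ₜ[ℝ] ((F z - F y - B (z - y)) + (B - A) (z - y))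
        - (TensorProduct.mapL B B - TensorProduct.mapL A A) (X.lvl2 u t) := by
    simp only [almostIntegral]
    rw [← hx, ← hy, ← hA, ← hB, hXeq, map_add, map_add, TensorProduct.mapL_tmul]
    simp only [sub_apply, TensorProduct.sub_tmul,
      TensorProduct.tmul_sub, TensorProduct.tmul_add]
    abel
  rw [hsplit]
  have b1 : ‖(F y - F x - A (y - x)) ⊗ₜ[ℝ] (F z - F y)‖ ≤ M * (P * P) * (M * P) := by
    rw [TensorProduct.norm_tmul]
    refine mul_le_mul ((hF.taylor_one x y).trans ?_) ((hF.norm_image_sub_le y z).trans ?_)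
      (norm_nonneg _) (by positivity) <;> gcongr
  have b2 : ‖A (y - x) ⊗ₜ[ℝ] ((F z - F y - B (z - y)) + (B - A) (z - y))‖
      ≤ M * P * (M * (P * P) + M * P * P) := by
    rw [TensorProduct.norm_tmul]
    refine mul_le_mul (A.le_of_opNorm_le_of_le (hF.fderiv_le x) hxsu)
      ((norm_add_le _ _).trans (add_le_add ((hF.taylor_one y z).trans (by gcongr)) ?_))
      (norm_nonneg _) (by positivity)
    exact (B - A).le_of_opNorm_le_of_le ((hF.norm_fderiv_sub_le x y).trans (by gcongr)) hxut
  have b3 : ‖(TensorProduct.mapL B B - TensorProduct.mapL A A) (X.lvl2 u t)‖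
      ≤ (M + M) * (M * P) * Q := by
    refine ContinuousLinearMap.le_of_opNorm_le_of_le _ ((norm_mapL_self_sub_le B A).trans ?_) hXut
    have := hF.fderiv_le x
    have := hF.fderiv_le y
    have : ‖B - A‖ ≤ M * P := (hF.norm_fderiv_sub_le x y).trans (by gcongr)
    gcongr
  refine (norm_sub_le _ _).trans (add_le_add ((norm_sub_le _ _).trans (add_le_add ?_ b2)) b3)
  rwa [norm_neg]

theorem HasHolderHessian.exists_roughIntegral [FiniteDimensional ℝ W]
    (hF : HasHolderHessian α M F) (hα : 0 < α) (hα1 : α ≤ 1) (hp2 : 2 ≤ p) (hp3 : p < 3)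
    (hT : 0 ≤ T) (hH : IsClock T H) (hX : RoughBounds p T H X) (hS : HasShuffle T X) :
    ∃ Y : TwoLevel W, RoughBounds p T H Y ∧
      (∀ s t, Y.lvl1 s t = F (X.path t) - F (X.path s)) ∧
      BigO T H ((2 + α) / p) (fun s t => Y.lvl1 s t - (almostIntegral (fderiv ℝ F) X).lvl1 s t) ∧
      BigO T H ((2 + α) / p)
        (fun s t => Y.lvl2 s t - (almostIntegral (fderiv ℝ F) X).lvl2 s t) := by
  have hp : 0 < p := by linarith
  have hp1 : 0 ≤ 1 / p := by positivity
  obtain ⟨J, hJ⟩ := hF.exists_lvl2 hp2 hp3 hT hH hX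
  refine ⟨⟨fun s t => F (X.path t) - F (X.path s), fun s t => J t - J s
      - F (X.path s) ⊗ₜ[ℝ] (F (X.path t) - F (X.path s))⟩, ⟨?_, ?_, ?_, ?_⟩, fun _ _ => rfl,
      hF.bigO_lvl1 hα hp hH hX hS, hJ.weaken hH (by positivity) (by gcongr; linarith)⟩
  · intro s u t _ _ _ _
    simp only
    abel
  · intro s u t _ _ _ _
    simp only [TensorProduct.tmul_sub, TensorProduct.sub_tmul]
    abel
  · exact hX.bigO_path.of_norm_le_mul_norm hH hp1 M fun s t _ _ _ => hF.norm_image_sub_le _ _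
  · have h1 : BigO T H (2 / p) (almostIntegral (fderiv ℝ F) X).lvl2 :=
      hX.bigO_lvl2.of_norm_le_mul_norm hH (by positivity) (M * M) fun s t _ _ _ =>
        ContinuousLinearMap.le_of_opNorm_le _ ((TensorProduct.norm_mapL_le _ _).trans
          (mul_le_mul (hF.fderiv_le _) (hF.fderiv_le _) (norm_nonneg _) hF.nonneg)) _
    exact ((hJ.weaken hH (by positivity) (by gcongr; norm_num)).add h1).congr
      fun s t _ _ _ => (sub_add_cancel _ _).symm

end Gradient

/-! ### Iterated Young integrals against the perturbation -/

section Iterated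

variable {T : ℝ} {H : ℝ → ℝ} {a b c : ℝ}

/-- A path with increments of nonnegative order is bounded. -/
theorem BigO.exists_bound {E : Type*} [NormedAddCommGroup E] (hH : IsClock T H) (ha : 0 ≤ a)
    {g : ℝ → E} (hg : BigO T H a (incr g)) : ∃ C, ∀ t, 0 ≤ t → t ≤ T → ‖g t‖ ≤ C := by
  obtain ⟨C, -, h⟩ := hg.weaken hH le_rfl ha
  refine ⟨‖g 0‖ + C, fun t h0 h1 => ?_⟩
  have := h 0 t le_rfl h0 h1
  rw [Real.rpow_zero, mul_one, incr] at this
  calc ‖g t‖ = ‖g 0 + (g t - g 0)‖ := by congr 1; abel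
    _ ≤ _ := (norm_add_le _ _).trans (by linarith)

theorem BigO.left {E : Type*} [NormedAddCommGroup E] (hH : IsClock T H) (ha : 0 ≤ a)
    {g : ℝ → E} (hg : BigO T H a (incr g)) : BigO T H 0 (fun s _ => g s) := by
  obtain ⟨C, h⟩ := hg.exists_bound hH ha
  exact BigO.of_bounded C fun s t hs hst ht => h s hs (hst.trans ht)

theorem BigO.right {E : Type*} [NormedAddCommGroup E] (hH : IsClock T H) (ha : 0 ≤ a)
    {g : ℝ → E} (hg : BigO T H a (incr g)) : BigO T H 0 (fun _ t => g t) := by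
  obtain ⟨C, h⟩ := hg.exists_bound hH ha
  exact BigO.of_bounded C fun s t hs hst ht => h t (hs.trans hst) ht

variable {G V W : Type*} [NormedAddCommGroup G] [NormedSpace ℝ G]
  [NormedAddCommGroup V] [InnerProductSpace ℝ V] [FiniteDimensional ℝ V]
  [NormedAddCommGroup W] [InnerProductSpace ℝ W] [FiniteDimensional ℝ W]

theorem tmulL_sub (v v' : V) : tmulL (W := W) (v - v') = tmulL v - tmulL v' := by
  ext w; simp [TensorProduct.sub_tmul]

theorem norm_tmulL_le (v : V) : ‖tmulL (W := W) v‖ ≤ ‖v‖ :=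
  ContinuousLinearMap.opNorm_le_bound _ (norm_nonneg v) fun w => by simp

/-- The increments of a Young primitive `K = ∫ f dg` have the order of those of `g`. -/
theorem BigO.incr_of_young {C : Type*} [NormedAddCommGroup C] [NormedSpace ℝ C]
    (hH : IsClock T H) (ha : 0 ≤ a) (hb : 0 ≤ b) {f : ℝ → G →L[ℝ] C} {g : ℝ → G} {K : ℝ → C}
    (hf : BigO T H a (incr f)) (hg : BigO T H b (incr g))
    (hK : BigO T H (a + b) (fun s t => K t - K s - f s (g t - g s))) : BigO T H b (incr K) := by
  have h1 := BigO.mul_of_norm_le hH le_rfl hb 1 (hf.left hH ha) hg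
    (R := fun s t => f s (g t - g s)) fun s t _ _ _ => by
      rw [one_mul]; exact (f s).le_opNorm _
  rw [zero_add] at h1
  exact ((hK.weaken hH hb (by linarith)).add h1).congr fun s t _ _ _ => (sub_add_cancel _ _).symm

/-- The iterated integral `B s t = ∫_s^t (k_u - k_s) ⊗ dy_u`. -/
theorem exists_tmul_young (hT : 0 ≤ T) (hH : IsClock T H) (ha : 0 < a) (hb : 0 < b) (ha1 : a ≤ 1)
    (hb1 : b ≤ 1) (hab : 1 < a + b) {k : ℝ → V} {y : ℝ → W} (hk : BigO T H a (incr k))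
    (hy : BigO T H b (incr y)) : ∃ B : ℝ → ℝ → V ⊗[ℝ] W,
      (∀ s t, 0 ≤ s → s ≤ t → t ≤ T →
        HasYoungIntegral (fun u => tmulL (k u - k s)) y s t (B s t)) ∧
      (∀ s u t, B s t = B s u + B u t + (k u - k s) ⊗ₜ[ℝ] (y t - y u)) ∧
      BigO T H (a + b) B := by
  have hf : BigO T H a (incr fun u => tmulL (W := W) (k u)) :=
    hk.of_norm_le_mul_norm hH ha.le 1 fun s t _ _ _ => by
      rw [one_mul, incr, ← tmulL_sub]; exact norm_tmulL_le _
  obtain ⟨J, hJ, hJY⟩ := exists_young hT hH ha hb ha1 hb1 hab hf hy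
  refine ⟨fun s t => J t - J s - k s ⊗ₜ[ℝ] (y t - y s), fun s t hs hst ht => ?_,
    fun s u t => ?_, hJ⟩
  · have := (hJY s t hs hst ht).sub_const (tmulL (k s))
    exact this.congr fun u _ _ => tmulL_sub _ _
  · simp only [TensorProduct.sub_tmul, TensorProduct.tmul_sub]; abel

/-- The iterated integral `B s t = ∫_s^t (y_u - y_s) ⊗ dK_u`, where `K = ∫ D dφ`. -/
theorem exists_tmul_comp_young {U : Type*} [NormedAddCommGroup U] [InnerProductSpace ℝ U]
    [FiniteDimensional ℝ U] (hT : 0 ≤ T) (hH : IsClock T H) (ha : 0 < a)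
    (hb : 0 < b) (ha1 : a ≤ 1) (hb1 : b ≤ 1) (hab : 1 < a + b) (hac : a ≤ c) {D : ℝ → G →L[ℝ] W}
    {φ : ℝ → G} {K : ℝ → W} {y : ℝ → U} (hD : BigO T H a (incr D)) (hφ : BigO T H b (incr φ))
    (hK : BigO T H (a + b) (fun s t => K t - K s - D s (φ t - φ s)))
    (hKY : ∀ s t, 0 ≤ s → s ≤ t → t ≤ T → HasYoungIntegral D φ s t (K t - K s))
    (hy : BigO T H c (incr y)) : ∃ B : ℝ → ℝ → U ⊗[ℝ] W,
      (∀ s t, 0 ≤ s → s ≤ t → t ≤ T →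
        HasYoungIntegral (fun u => (tmulL (y u - y s)).comp (D u)) φ s t (B s t)) ∧
      (∀ s u t, B s t = B s u + B u t + (y u - y s) ⊗ₜ[ℝ] (K t - K u)) ∧
      BigO T H (a + b) B := by
  have hc : 0 ≤ c := ha.le.trans hac
  have hcomp : ∀ (v : U) (L : G →L[ℝ] W), ‖(tmulL v).comp L‖ ≤ 1 * (‖v‖ * ‖L‖) := fun v L => by
    rw [one_mul]
    exact (ContinuousLinearMap.opNorm_comp_le _ _).trans (by gcongr; exact norm_tmulL_le v)
  have hf : ∀ v : U, BigO T H a (incr fun u => (tmulL (y u - v)).comp (D u)) := by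
    intro v
    have hyv : BigO T H c (incr fun u => y u - v) := hy.congr fun s t _ _ _ => by
      simp only [incr]; abel
    have e1 := BigO.mul_of_norm_le hH hc le_rfl 1 hy (hD.right hH ha.le)
      (R := fun s t => (tmulL (y t - y s)).comp (D t)) fun s t _ _ _ => hcomp _ _
    have e2 := BigO.mul_of_norm_le hH le_rfl ha.le 1 (hyv.left hH hc) hD
      (R := fun s t => (tmulL (y s - v)).comp (D t - D s)) fun s t _ _ _ => hcomp _ _
    rw [zero_add] at e2
    rw [add_zero] at e1
    refine ((e1.weaken hH ha.le hac).add e2).congr fun s t _ _ _ => ?_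
    ext z
    simp only [incr, sub_apply, add_apply, ContinuousLinearMap.comp_apply, tmulL_apply,
      TensorProduct.sub_tmul, TensorProduct.tmul_sub]
    abel
  have hf0 : BigO T H a (incr fun u => (tmulL (y u)).comp (D u)) := by simpa using hf 0
  obtain ⟨J, hJ, hJY⟩ := exists_young hT hH ha hb ha1 hb1 hab hf0 hφ
  refine ⟨fun s t => J t - J s - y s ⊗ₜ[ℝ] (K t - K s), fun s t hs hst ht => ?_,
    fun s u t => ?_, ?_⟩
  · refine hasYoungIntegral_of_isRSLimit hH ha hb ha1 hb1 hab (hf (y s)) hφ hs ht ?_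
    have := (hJY s t hs hst ht).limit.sub ((hKY s t hs hst ht).limit.clm_comp (tmulL (y s)))
    have e : (fun u => (tmulL (y u - y s)).comp (D u))
        = fun u => (tmulL (y u)).comp (D u) - (tmulL (y s)).comp (D u) := by
      funext u; rw [tmulL_sub, ContinuousLinearMap.sub_comp]
    rw [e]
    exact this
  · simp only [TensorProduct.sub_tmul, TensorProduct.tmul_sub]; abel
  · have e1 := BigO.mul_of_norm_le hH le_rfl (by linarith) 1 (hy.left hH hc) hK
      (R := fun s t => y s ⊗ₜ[ℝ] (K t - K s - D s (φ t - φ s))) fun s t _ _ _ => by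
        rw [TensorProduct.norm_tmul, one_mul]
    rw [zero_add] at e1
    refine (hJ.sub e1).congr fun s t _ _ _ => ?_
    simp only [ContinuousLinearMap.comp_apply, tmulL_apply, TensorProduct.tmul_sub]
    abel

end Iterated

/-! ### The perturbed rough integral -/

section Perturbed

variable {V W : Type*} [NormedAddCommGroup V] [InnerProductSpace ℝ V]
  [NormedAddCommGroup W] [InnerProductSpace ℝ W]
  {F : SpaceTime V → W} {α M p T : ℝ} {H : ℝ → ℝ} {X : TwoLevel V} {φ : ℝ → V ⊗[ℝ] V}

theorem HasHolderHessian.bigO_mapL_Dx (hF : HasHolderHessian α M F) (hp : 0 < p)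
    (hH : IsClock T H) (hX : RoughBounds p T H (spaceTime X)) :
    BigO T H (1 / p)
      (incr fun u => TensorProduct.mapL (Dx F (X.path u) u) (Dx F (X.path u) u)) := by
  have hM := hF.nonneg
  have hbd : ∀ z, ‖(fderiv ℝ F z).comp (inSpace V)‖ ≤ M * ‖inSpace V‖ := fun z =>
    (ContinuousLinearMap.opNorm_comp_le _ _).trans (by gcongr; exact hF.fderiv_le z)
  refine hX.bigO_path.of_norm_le_mul_norm hH (by positivity)
    ((M * ‖inSpace V‖ + M * ‖inSpace V‖) * (M * ‖inSpace V‖)) fun s t _ _ _ => ?_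
  rw [incr, incr, hF.Dx_eq, hF.Dx_eq, spaceTime_path, spaceTime_path]
  refine (norm_mapL_self_sub_le _ _).trans ?_
  rw [← ContinuousLinearMap.sub_comp, mul_assoc]
  refine mul_le_mul (add_le_add (hbd _) (hbd _)) ?_ (norm_nonneg _) (by positivity)
  calc _ ≤ M * ‖pt (X.path t) t - pt (X.path s) s‖ * ‖inSpace V‖ :=
        (ContinuousLinearMap.opNorm_comp_le _ _).trans
          (by gcongr; exact hF.norm_fderiv_sub_le _ _)
    _ = _ := by ring

variable [FiniteDimensional ℝ V]

theorem HasHolderHessian.bigO_Dxx [FiniteDimensional ℝ W] (hF : HasHolderHessian α M F)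
    (hα : 0 ≤ α) (hp : 0 < p) (hH : IsClock T H) (hX : RoughBounds p T H (spaceTime X)) :
    BigO T H (α / p) (incr fun u => Dxx F (X.path u) u) := by
  set ι := TensorProduct.mapL (inSpace V) (inSpace V)
  have h := hX.bigO_path.norm_rpow hH hα
  rw [← div_eq_mul_one_div] at h
  obtain ⟨C, hC, hcontract⟩ := exists_norm_contract_sub_le (SpaceTime V) W
  refine h.of_norm_le_mul_norm hH (by positivity) (C * M * ‖ι‖) fun s t _ _ _ => ?_
  rw [Real.norm_of_nonneg (by positivity), incr, incr, hF.Dxx_eq, hF.Dxx_eq,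
    ← ContinuousLinearMap.sub_comp, spaceTime_path, spaceTime_path]
  calc _ ≤ C * (M * ‖pt (X.path t) t - pt (X.path s) s‖ ^ α) * ‖ι‖ := by
        refine (ContinuousLinearMap.opNorm_comp_le _ _).trans ?_
        gcongr
        exact (hcontract _ _).trans (by gcongr; exact hF.holder _ _)
    _ = _ := by ring

/-- Replacing `X` by `X(φ)` changes the first level of the almost rough path of `DF` by
`D_x²F(X_s, s) (φ_t - φ_s)`. -/
theorem HasHolderHessian.almostIntegral_perturb_lvl1 (hF : HasHolderHessian α M F) (s t : ℝ) :
    (almostIntegral (fderiv ℝ F) (spaceTime (perturb X φ))).lvl1 s t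
      = (almostIntegral (fderiv ℝ F) (spaceTime X)).lvl1 s t
        - Dxx F (X.path s) s (φ t - φ s) := by
  have hpath : (spaceTime (perturb X φ)).path s = (spaceTime X).path s := rfl
  simp only [almostIntegral]
  rw [hpath, spaceTime_perturb_lvl1, spaceTime_perturb_lvl2, map_sub, hF.Dxx_eq, spaceTime_path,
    ContinuousLinearMap.comp_apply]
  abel

theorem HasHolderHessian.almostIntegral_perturb_lvl2 (hF : HasHolderHessian α M F) (s t : ℝ) :
    (almostIntegral (fderiv ℝ F) (spaceTime (perturb X φ))).lvl2 s t
      = (almostIntegral (fderiv ℝ F) (spaceTime X)).lvl2 s t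
        - TensorProduct.mapL (Dx F (X.path s) s) (Dx F (X.path s) s) (φ t - φ s) := by
  have hpath : (spaceTime (perturb X φ)).path s = (spaceTime X).path s := rfl
  simp only [almostIntegral]
  rw [hpath, spaceTime_perturb_lvl2, map_sub, hF.Dx_eq, spaceTime_path, TensorProduct.mapL_comp,
    ContinuousLinearMap.comp_apply]

/-- The integral `Y` of `DF` along `X̃`, the integral `Z` along `X̃(φ)`, and the Young integrals that
relate them. `Z` is defined from `Y` by the Itô formula; that it is the rough integral along
`X̃(φ)` follows from Chen's identity and from the orders of the Young integrals. -/
theorem HasHolderHessian.exists_perturbed_roughIntegral [FiniteDimensional ℝ W]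
    (hF : HasHolderHessian α M F) (hα : 0 < α) (hα1 : α ≤ 1) (hpα : p < 2 + α) (hp2 : 2 ≤ p)
    (hT : 0 ≤ T) (hH : IsClock T H)
    (hX : RoughBounds p T H (spaceTime X)) (hφ : BigO T H (2 / p) (incr φ)) {Y : TwoLevel W}
    (hY : RoughBounds p T H Y)
    (hY1 : ∀ s t, Y.lvl1 s t = F (pt (X.path t) t) - F (pt (X.path s) s))
    (hYa1 : BigO T H ((2 + α) / p)
      (fun s t => Y.lvl1 s t - (almostIntegral (fderiv ℝ F) (spaceTime X)).lvl1 s t))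
    (hYa2 : BigO T H ((2 + α) / p)
      (fun s t => Y.lvl2 s t - (almostIntegral (fderiv ℝ F) (spaceTime X)).lvl2 s t)) :
    ∃ (K : ℝ → W) (I₁ I₂ I₃ I₄ : ℝ → ℝ → W ⊗[ℝ] W),
      IsRoughIntegral p T (fderiv ℝ F) (spaceTime (perturb X φ))
        ⟨fun s t => Y.lvl1 s t - (K t - K s),
          fun s t => Y.lvl2 s t - I₁ s t - I₂ s t - I₃ s t + I₄ s t⟩ ∧
      ∀ s t, 0 ≤ s → s ≤ t → t ≤ T →
        HasYoungIntegral (fun u => Dxx F (X.path u) u) φ s t (K t - K s) ∧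
        HasYoungIntegral
          (fun u => TensorProduct.mapL (Dx F (X.path u) u) (Dx F (X.path u) u)) φ s t (I₁ s t) ∧
        HasYoungIntegral (fun u => tmulL (W := W) (K u - K s))
          (fun u => F (pt (X.path u) u)) s t (I₂ s t) ∧
        HasYoungIntegral
          (fun u => (tmulL (F (pt (X.path u) u) - F (pt (X.path s) s))).comp
            (Dxx F (X.path u) u)) φ s t (I₃ s t) ∧
        HasYoungIntegral (fun u => (tmulL (K u - K s)).comp (Dxx F (X.path u) u)) φ s t
          (I₄ s t) := by
  have hp : 0 < p := by linarith
  have hαp : 0 < α / p := by positivity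
  have hp1 : 0 < 1 / p := by positivity
  have hp2' : 0 < 2 / p := by positivity
  have hαp1 : α / p ≤ 1 := by rw [div_le_one hp]; linarith
  have hp11 : 1 / p ≤ 1 := by rw [div_le_one hp]; linarith
  have hp21 : 2 / p ≤ 1 := by rw [div_le_one hp]; linarith
  have hαp' : α / p ≤ 1 / p := by gcongr
  have h12 : 1 / p ≤ 2 / p := by gcongr; norm_num
  have hsum : α / p + 2 / p = (2 + α) / p := by ring
  have hθ : 1 < (2 + α) / p := by rw [lt_div_iff₀ hp]; linarith
  have hYpath : BigO T H (1 / p) (incr fun u => F (pt (X.path u) u)) :=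
    hY.bigO_lvl1.congr fun s t _ _ _ => (hY1 s t).symm
  have hD := hF.bigO_Dxx hα.le hp hH hX
  have hA := hF.bigO_mapL_Dx hp hH hX
  obtain ⟨K, hK, hKY⟩ := exists_young hT hH hαp hp2' hαp1 hp21 (by linarith) hD hφ
  have hKO : BigO T H (2 / p) (incr K) := BigO.incr_of_young hH hαp.le hp2'.le hD hφ hK
  obtain ⟨J, hJ, hJY⟩ := exists_young hT hH hp1 hp2' hp11 hp21 (by linarith) hA hφ
  obtain ⟨I₂, hI₂, hI₂c, hI₂O⟩ := exists_tmul_young hT hH hp2' hp1 hp21 hp11 (by linarith) hKO hYpath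
  obtain ⟨I₃, hI₃, hI₃c, hI₃O⟩ := exists_tmul_comp_young hT hH hαp hp2' hαp1 hp21 (by linarith)
    hαp' hD hφ hK hKY hYpath
  obtain ⟨I₄, hI₄, hI₄c, hI₄O⟩ := exists_tmul_comp_young hT hH hαp hp2' hαp1 hp21 (by linarith)
    (hαp'.trans h12) hD hφ hK hKY hKO
  have hJO : BigO T H (2 / p) (incr J) := BigO.incr_of_young hH hp1.le hp2'.le hA hφ hJ
  have hJ' := hJ.weaken hH (a := (2 + α) / p) (by positivity) (by rw [← hsum]; linarith)
  have hI₂' := hI₂O.weaken hH (a := (2 + α) / p) (by positivity) (by rw [← hsum]; linarith)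
  rw [hsum] at hK hI₃O hI₄O
  refine ⟨K, fun s t => J t - J s, I₂, I₃, I₄, ?_, fun s t hs hst ht =>
    ⟨hKY s t hs hst ht, hJY s t hs hst ht, hI₂ s t hs hst ht, hI₃ s t hs hst ht,
      hI₄ s t hs hst ht⟩⟩
  have hw : ∀ {R : ℝ → ℝ → W ⊗[ℝ] W}, BigO T H ((2 + α) / p) R → BigO T H (2 / p) R := fun h =>
    h.weaken hH hp2'.le (by gcongr; linarith)
  refine RoughBounds.isRoughIntegral (H := H) ⟨?_, ?_, ?_, ?_⟩ hp hH hθ ?_ ?_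
  · intro s u t hs hsu hut ht
    simp only
    rw [hY.chen_lvl1 s u t hs hsu hut ht]; abel
  · intro s u t hs hsu hut ht
    simp only
    rw [hY.chen_lvl2 s u t hs hsu hut ht, hI₂c s u t, hI₃c s u t, hI₄c s u t, hY1 s u, hY1 u t]
    generalize F (pt (X.path s) s) = ys
    generalize F (pt (X.path u) u) = yu
    generalize F (pt (X.path t) t) = yt
    simp only [TensorProduct.sub_tmul, TensorProduct.tmul_sub]
    abel
  · exact hY.bigO_lvl1.sub (hKO.weaken hH hp1.le h12)
  · exact (((hY.bigO_lvl2.sub hJO).sub (hw hI₂')).sub (hw hI₃O)).add (hw hI₄O)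
  · refine (hYa1.sub hK).congr fun s t _ _ _ => ?_
    simp only [hF.almostIntegral_perturb_lvl1]
    abel
  · refine ((((hYa2.sub hJ').sub hI₂').sub hI₃O).add hI₄O).congr fun s t _ _ _ => ?_
    simp only [hF.almostIntegral_perturb_lvl2]
    abel

end Perturbed

end RoughIto

/-! ### The inhomogeneous Itô formula -/

theorem mainTheorem4 {d : ℕ} {W : Type*} [NormedAddCommGroup W] [InnerProductSpace ℝ W]
    [FiniteDimensional ℝ W] (p T q γ : ℝ) (hp2 : 2 ≤ p) (hp3 : p < 3) (hT : 0 < T)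
    (X : TwoLevel (EuclideanSpace ℝ (Fin d))) (hX : IsGeometricRoughPath p T X)
    (φ : ℝ → EuclideanSpace ℝ (Fin d) ⊗[ℝ] EuclideanSpace ℝ (Fin d))
    (hφc : ContinuousOn φ (Set.Icc 0 T)) (hq0 : 0 < q) (hqp : q ≤ p / 2)
    (hφ : HasFinitePVar q 0 T (incr φ))
    (F : SpaceTime (EuclideanSpace ℝ (Fin d)) → W) (hγ : p < γ) (hF : IsLip γ F) :
    -- the space-time rough paths and the two rough integrals are well defined
    (∀ s t, 0 ≤ s → s ≤ t → t ≤ T →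
      YoungIntegrable (crossLeft X s) (fun u => u) s t ∧
      YoungIntegrable (crossRight (EuclideanSpace ℝ (Fin d)) s) X.path s t) ∧
    IsRoughPath p T (spaceTime X) ∧
    IsRoughPath p T (spaceTime (perturb X φ)) ∧
    (∃ Y : TwoLevel W, IsRoughIntegral p T (fderiv ℝ F) (spaceTime X) Y) ∧
    (∃ Z : TwoLevel W, IsRoughIntegral p T (fderiv ℝ F) (spaceTime (perturb X φ)) Z) ∧
    -- the formulas, for `Y = ∫ DF(X̃) dX̃` and `Z = ∫ DF(X̃(φ)) dX̃(φ)`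
    ∀ Y Z : TwoLevel W,
      IsRoughIntegral p T (fderiv ℝ F) (spaceTime X) Y →
      IsRoughIntegral p T (fderiv ℝ F) (spaceTime (perturb X φ)) Z →
      ∀ s t, 0 ≤ s → s ≤ t → t ≤ T →
        -- (i)
        F (pt (X.path t) t) - F (pt (X.path s) s) = Y.lvl1 s t ∧
        -- (ii)
        YoungIntegrable (fun u => Dxx F (X.path u) u) φ s t ∧
        F (pt (X.path t) t) - F (pt (X.path s) s)
          = Z.lvl1 s t + youngIntegral (fun u => Dxx F (X.path u) u) φ s t ∧
        -- (iii)
        YoungIntegrable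
          (fun u => TensorProduct.mapL (Dx F (X.path u) u) (Dx F (X.path u) u)) φ s t ∧
        YoungIntegrable
          (fun u => tmulL (W := W) (youngIntegral (fun r => Dxx F (X.path r) r) φ s u))
          (fun u => F (pt (X.path u) u)) s t ∧
        YoungIntegrable
          (fun u => (tmulL (F (pt (X.path u) u) - F (pt (X.path s) s))).comp
            (Dxx F (X.path u) u)) φ s t ∧
        YoungIntegrable
          (fun u => (tmulL (youngIntegral (fun r => Dxx F (X.path r) r) φ s u)).comp
            (Dxx F (X.path u) u)) φ s t ∧
        Y.lvl2 s t
          = Z.lvl2 s t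
            + youngIntegral
                (fun u => TensorProduct.mapL (Dx F (X.path u) u) (Dx F (X.path u) u)) φ s t
            + youngIntegral
                (fun u => tmulL (W := W) (youngIntegral (fun r => Dxx F (X.path r) r) φ s u))
                (fun u => F (pt (X.path u) u)) s t
            + youngIntegral
                (fun u => (tmulL (F (pt (X.path u) u) - F (pt (X.path s) s))).comp
                  (Dxx F (X.path u) u)) φ s t
            - youngIntegral
                (fun u => (tmulL (youngIntegral (fun r => Dxx F (X.path r) r) φ s u)).comp
                  (Dxx F (X.path u) u)) φ s t := by
  have hp : 0 < p := by linarith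
  have hT0 : 0 ≤ T := hT.le
  obtain ⟨α, M, hα, hα1, hpα, hFM⟩ := hF.exists_hasHolderHessian hp2 hp3 hγ
  -- one clock that controls the rough path, the perturbation and time
  obtain ⟨H₁, hH₁, hXb⟩ := hX.1.exists_roughBounds hp
  have hsnd : Set.MapsTo (fun z : ℝ × ℝ => z.2) (simplex T) (Set.Icc 0 T) := fun z hz =>
    ⟨hz.1.trans hz.2.1, hz.2.2⟩
  have hfst : Set.MapsTo (fun z : ℝ × ℝ => z.1) (simplex T) (Set.Icc 0 T) := fun z hz =>
    ⟨hz.1, hz.2.1.trans hz.2.2⟩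
  obtain ⟨H₂, hH₂, hφb⟩ := exists_clock hq0 (Z := incr φ)
    ((hφc.comp continuousOn_snd hsnd).sub (hφc.comp continuousOn_fst hfst))
    (fun t _ _ => sub_self _) hφ
  obtain ⟨H, hH, hXb, hφb, htime⟩ : ∃ H, IsClock T H ∧ RoughBounds p T H X ∧
      BigO T H (2 / p) (incr φ) ∧ BigO T H 1 (incr fun t : ℝ => t) := by
    refine ⟨_, (hH₁.add hH₂).add (isClock_id T),
      (hXb.add_clock_right hp hH₁ hH₂).add_clock_right hp (hH₁.add hH₂) (isClock_id T), ?_, ?_⟩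
    · have h2 : 2 / p ≤ 1 / q := by
        rw [div_le_div_iff₀ hp hq0]; linarith
      exact ((hφb.weaken hH₂ (by positivity) h2).add_clock_left (by positivity) hH₁
        hH₂).add_clock_right (by positivity) (hH₁.add hH₂) (isClock_id T)
    · refine BigO.add_clock_left zero_le_one (hH₁.add hH₂) (isClock_id T) ?_
      refine BigO.of_norm_le (isClock_id T) 1 fun s t _ hst _ => ?_
      rw [Real.rpow_one, one_mul, incr, Real.norm_of_nonneg (sub_nonneg.2 hst)]
  have hXt := hXb.spaceTime hp2 hT0 hH htime
  have hXφ := (hXb.perturb hφb).spaceTime hp2 hT0 hH htime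
  have hS := (hX.hasShuffle hp).spaceTime hXb (by linarith) hT0 hH htime
  obtain ⟨Y, hY, hY1, hYa1, hYa2⟩ :=
    hFM.exists_roughIntegral hα hα1 hp2 hp3 hT0 hH hXt hS
  have hθ : 1 < (2 + α) / p := by rw [lt_div_iff₀ hp]; linarith
  have hYint := hY.isRoughIntegral hp hH hθ hYa1 hYa2
  simp only [spaceTime_path] at hY1
  obtain ⟨K, I₁, I₂, I₃, I₄, hZint, hyoung⟩ := hFM.exists_perturbed_roughIntegral hα hα1 hpα hp2
    hT0 hH hXt hφb hY hY1 hYa1 hYa2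
  refine ⟨fun s t hs hst ht => hXb.youngIntegrable_cross (by linarith) hT0 hH htime hs hst ht,
    hXt.isRoughPath hp hH, hXφ.isRoughPath hp hH, ⟨Y, hYint⟩, ⟨_, hZint⟩, ?_⟩
  intro Y' Z' hY' hZ' s t hs hst ht
  obtain ⟨y1, y2⟩ := hY'.unique hYint hs hst ht
  obtain ⟨z1, z2⟩ := hZ'.unique hZint hs hst ht
  obtain ⟨k, i1, i2, i3, i4⟩ := hyoung s t hs hst ht
  have hKeq : ∀ u, s ≤ u → u ≤ t →
      youngIntegral (fun r => Dxx F (X.path r) r) φ s u = K u - K s := fun u hsu hut =>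
    (hyoung s u hs hsu (hut.trans ht)).1.youngIntegral_eq hsu
  have j2 := i2.congr (f' := fun u =>
    tmulL (W := W) (youngIntegral (fun r => Dxx F (X.path r) r) φ s u))
    fun u hsu hut => by rw [hKeq u hsu hut]
  have j4 := i4.congr (f' := fun u =>
    (tmulL (youngIntegral (fun r => Dxx F (X.path r) r) φ s u)).comp (Dxx F (X.path u) u))
    fun u hsu hut => by rw [hKeq u hsu hut]
  refine ⟨by rw [y1, hY1], ⟨_, k⟩, ?_, ⟨_, i1⟩, ⟨_, j2⟩, ⟨_, i3⟩, ⟨_, j4⟩, ?_⟩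
  · rw [z1, k.youngIntegral_eq hst, ← hY1]
    simp only [sub_add_cancel]
  · rw [y2, z2, i1.youngIntegral_eq hst, j2.youngIntegral_eq hst, i3.youngIntegral_eq hst,
      j4.youngIntegral_eq hst]
    simp only
    abel
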